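/- Let $\Omega\subset\mathbb{R}^d$ be a bounded open set, $H=L^2(\Omega)$, $V=H^1_0(\Omega)$, $Y=[0,1]^d$ and $T>0$. Let $\mathcal C_{11},\mathcal C_{22},\kappa_1,\kappa_2,Q$ be real functions of $(x,y)\in\Omega\times\mathbb{R}^d$ that are continuous, bounded and $Y$-periodic in $y$, with $\int_Y Q(x,y)\,dy=0$ for every $x\in\Omega$, and with $\mathcal C_{ii}\ge\underline C>0$ and $\kappa_i\ge\underline\kappa>0$ for constants $\underline C,\underline\kappa$. Let $q\in L^2((0,T)\times\Omega)$ and $g_1,g_2\in H$. For $\varepsilon>0$ and a function $a$ of $(x,y)$ put $a^\varepsilon(x)=a(x,x/\varepsilon)$, and consider the system, in $(0,T)\times\Omega$, $$\mathcal C_{11}^\varepsilon\,\partial_t u_1^\varepsilon=\operatorname{div}(\kappa_1^\varepsilon\nabla u_1^\varepsilon)+\tfrac1\varepsilon Q^\varepsilon(u_2^\varepsilon-u_1^\varepsilon)+q,$$ $$\mathcal C_{22}^\varepsilon\,\partial_t u_2^\varepsilon=\operatorname{div}(\kappa_2^\varepsilon\nabla u_2^\varepsilon)+\tfrac1\varepsilon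 Q^\varepsilon(u_1^\varepsilon-u_2^\varepsilon)+q,$$ with $u_i^\varepsilon=0$ on $\partial\Omega$ and $u_i^\varepsilon(0)=g_i$. A weak solution is a pair $u_1^\varepsilon,u_2^\varepsilon\in L^2(0,T;V)$ such that, for $(i,j)=(1,2)$ and $(2,1)$, all $v\in V$ and all $\psi\in C^1([0,T])$ with $\psi(T)=0$, $$-\int_0^T\psi'\int_\Omega\mathcal C_{ii}^\varepsilon u_i^\varepsilon v\,dx\,dt+\int_0^T\psi\int_\Omega\kappa_i^\varepsilon\nabla u_i^\varepsilon\cdot\nabla v\,dx\,dt=\int_0^T\psi\int_\Omega\Big(\tfrac1\varepsilon Q^\varepsilon(u_j^\varepsilon-u_i^\varepsilon)+q\Big)v\,dx\,dt+\psi(0)\int_\Omega\mathcal C_{ii}^\varepsilon g_i v\,dx .$$ **Theorem.** Assume that $Q(x,y)=\operatorname{div}_y\mathcal Q(x,y)$ for $x\in\Omega$, $y\in\mathbb{R}^d$, where the vector field $\mathcal Q$ is $Y$-periodic in $y$ and belongs to $C^1(\bar\Omega;C^1(\bar Y))^d$, that is, $x\mapsto\mathcal Q(x,\cdot)$ is a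 $C^1$ map, up to the boundary of $\Omega$, into the space of $Y$-periodic $C^1$ vector fields on $\mathbb{R}^d$. Then there is a constant $K$, independent of $\varepsilon$, such that for every $\varepsilon>0$ every weak solution $(u_1^\varepsilon,u_2^\varepsilon)$ satisfies $$\|u_i^\varepsilon\|_{L^\infty(0,T;H)}\le K\quad\text{and}\quad\|u_i^\varepsilon\|_{L^2(0,T;V)}\le K\qquad(i=1,2).$$ -/

import Mathlib

open MeasureTheory Set Topology
open scoped ENNReal NNReal ContDiff BoundedContinuousFunction

noncomputable section

namespace DualContinuum

/-- Euclidean space `ℝ^d`. -/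
abbrev Sp (d : ℕ) : Type := EuclideanSpace ℝ (Fin d)

/-- The Lebesgue measure on `Ω`. -/
abbrev spaceMeasure {d : ℕ} (Ω : Set (Sp d)) : Measure (Sp d) := volume.restrict Ω

/-- The Lebesgue measure on the time interval `(0, T)`. -/
abbrev timeMeasure (T : ℝ) : Measure ℝ := volume.restrict (Ioo 0 T)

/-- The space `H = L²(Ω)`. -/
abbrev H {d : ℕ} (Ω : Set (Sp d)) : Type := Lp ℝ 2 (spaceMeasure Ω)

/-- The space `L²(Ω)^d`, in which the gradients live. -/
abbrev HVec {d : ℕ} (Ω : Set (Sp d)) : Type := Lp (Sp d) 2 (spaceMeasure Ω)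

/-- `φ` is a test function on `Ω`: smooth, with compact support contained in `Ω`. -/
structure IsTestFunction {d : ℕ} (Ω : Set (Sp d)) (φ : Sp d → ℝ) : Prop where
  smooth : ContDiff ℝ ∞ φ
  compact : HasCompactSupport φ
  support : tsupport φ ⊆ Ω

/-- The space `V = H¹₀(Ω)`: the closure of the test functions in the `H¹` norm
`(‖u‖² + ‖∇u‖²)^{1/2}`. An element is stored as the pair `(u, ∇u)` in `L²(Ω) × L²(Ω)^d`
(Hilbert product norm); the test function `φ` is the pair `(φ, ∇φ)`, and the second component of
an element is the weak gradient of the first. -/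
def V {d : ℕ} (Ω : Set (Sp d)) : Submodule ℝ (WithLp 2 (H Ω × HVec Ω)) :=
  (Submodule.span ℝ {w : WithLp 2 (H Ω × HVec Ω) | ∃ φ : Sp d → ℝ, IsTestFunction Ω φ ∧
    w.fst =ᵐ[spaceMeasure Ω] φ ∧
    w.snd =ᵐ[spaceMeasure Ω] fun x => gradient φ x}).topologicalClosure

/-- The function in `L²(Ω)` underlying an element of `H¹₀(Ω)`. -/
def V.fn {d : ℕ} {Ω : Set (Sp d)} (v : V Ω) : H Ω := (v : WithLp 2 (H Ω × HVec Ω)).fst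

/-- The weak gradient of an element of `H¹₀(Ω)`. -/
def V.grad {d : ℕ} {Ω : Set (Sp d)} (v : V Ω) : HVec Ω := (v : WithLp 2 (H Ω × HVec Ω)).snd

/-- The space `L²(0, T; V)`. -/
abbrev L2V {d : ℕ} (T : ℝ) (Ω : Set (Sp d)) : Type := Lp (V Ω) 2 (timeMeasure T)

/-- `Y`-periodicity for the unit cube `Y` of `ℝ^d`: period `1` in every coordinate direction. -/
def IsPeriodic {d : ℕ} {X : Type*} (f : Sp d → X) : Prop :=
  ∀ (i : Fin d) (y : Sp d), f (y + EuclideanSpace.single i 1) = f y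

/-- A two-scale coefficient `a(x, y)`: continuous and bounded for `x ∈ Ω`, and `Y`-periodic
in `y`. -/
structure IsCoefficient {d : ℕ} (Ω : Set (Sp d)) (a : Sp d → Sp d → ℝ) : Prop where
  continuousOn : ContinuousOn (fun p : Sp d × Sp d => a p.1 p.2) (Ω ×ˢ univ)
  bounded : ∃ M : ℝ, ∀ x ∈ Ω, ∀ y, |a x y| ≤ M
  periodic : ∀ x ∈ Ω, IsPeriodic (a x)

/-- The unit cube `Y` of `ℝ^d`. -/
def unitCube (d : ℕ) : Set (Sp d) := {y | ∀ i, y i ∈ Icc (0 : ℝ) 1}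

/-- The oscillating function `a^ε(x) = a(x, x/ε)`. -/
def osc {d : ℕ} (a : Sp d → Sp d → ℝ) (ε : ℝ) (x : Sp d) : ℝ := a x (ε⁻¹ • x)

/-- `f ∈ C¹(Ω̄; X)` for a normed space `X`: `f` is differentiable in `Ω`, and `f` and its
derivative are continuous up to the boundary. -/
def IsC1Closure {d : ℕ} {X : Type*} [NormedAddCommGroup X] [NormedSpace ℝ X]
    (Ω : Set (Sp d)) (f : Sp d → X) : Prop :=
  ContinuousOn f (closure Ω) ∧
    ∃ f' : Sp d → (Sp d →L[ℝ] X), ContinuousOn f' (closure Ω) ∧ ∀ x ∈ Ω, HasFDerivAt f (f' x) x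

/-- `R ∈ C¹(Ω̄; C¹(Ȳ))^d`, with `R` periodic in `y`. The space of periodic `C¹` functions, with its
norm `max (sup |f|) (sup |Df|)`, is identified through `f ↦ (f, Df)` with a closed subspace of a
product of spaces of bounded continuous functions with the sup norm. -/
structure IsC1C1 {d : ℕ} (Ω : Set (Sp d)) (R : Sp d → Sp d → Sp d) : Prop where
  periodic : ∀ x ∈ closure Ω, IsPeriodic (R x)
  regular : ∃ (F : Sp d → (Sp d →ᵇ Sp d)) (G : Sp d → (Sp d →ᵇ (Sp d →L[ℝ] Sp d))),
    (∀ x ∈ closure Ω, ∀ y, F x y = R x y ∧ HasFDerivAt (R x) (G x y) y) ∧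
    IsC1Closure Ω F ∧ IsC1Closure Ω G

/-- The divergence of a vector field on `ℝ^d`. -/
def divergence {d : ℕ} (R : Sp d → Sp d) (y : Sp d) : ℝ :=
  ∑ i : Fin d, (fderiv ℝ R y (EuclideanSpace.single i 1)) i

/-- The weak form, with initial condition `u(0) = g`, of the scalar parabolic equation
`c ∂u/∂t = div (k ∇u) + r (w - u) + q` in `(0, T) × Ω`, `u = 0` on `∂Ω`. It is tested with
`ψ(t) v(x)`, where `v ∈ H¹₀(Ω)`, `ψ ∈ C¹([0, T])` and `ψ(T) = 0`; so `c ∂u/∂t` is the time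
derivative, in the sense of distributions with values in the dual of `V`, of `c u`. -/
def WeakEquation {d : ℕ} (T : ℝ) (Ω : Set (Sp d)) (c k r : Sp d → ℝ) (q : ℝ × Sp d → ℝ)
    (g : H Ω) (u w : L2V T Ω) : Prop :=
  ∀ (v : V Ω) (ψ : ℝ → ℝ), ContDiff ℝ 1 ψ → ψ T = 0 →
    - (∫ t in Ioo 0 T, deriv ψ t * ∫ x in Ω, c x * V.fn (u t) x * V.fn v x)
      + (∫ t in Ioo 0 T, ψ t * ∫ x in Ω, k x * inner ℝ (V.grad (u t) x) (V.grad v x))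
    = (∫ t in Ioo 0 T, ψ t * ∫ x in Ω, r x * (V.fn (w t) x - V.fn (u t) x) * V.fn v x)
      + (∫ t in Ioo 0 T, ψ t * ∫ x in Ω, q (t, x) * V.fn v x)
      + ψ 0 * ∫ x in Ω, c x * g x * V.fn v x

/-- `(u₁, u₂) ∈ L²(0, T; V)²` is a weak solution of the two-scale dual-continuum system
`C₁₁^ε ∂u₁/∂t = div (κ₁^ε ∇u₁) + (1/ε) Q^ε (u₂ - u₁) + q`,
`C₂₂^ε ∂u₂/∂t = div (κ₂^ε ∇u₂) + (1/ε) Q^ε (u₁ - u₂) + q` with the Dirichlet boundary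
condition and initial data `g₁`, `g₂`. -/
structure IsSolution {d : ℕ} (T : ℝ) (Ω : Set (Sp d)) (C₁₁ C₂₂ κ₁ κ₂ Q : Sp d → Sp d → ℝ)
    (q : ℝ × Sp d → ℝ) (g₁ g₂ : H Ω) (ε : ℝ) (u₁ u₂ : L2V T Ω) : Prop where
  first : WeakEquation T Ω (osc C₁₁ ε) (osc κ₁ ε) (fun x => (1 / ε) * osc Q ε x) q g₁ u₁ u₂
  second : WeakEquation T Ω (osc C₂₂ ε) (osc κ₂ ε) (fun x => (1 / ε) * osc Q ε x) q g₂ u₂ u₁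

end DualContinuum

end

/-!
The coefficient `ε⁻¹ Q^ε` of the exchange term is large, but it is, up to a bounded term, the
divergence of a bounded field: since `Q = div_y R`,
`ε⁻¹ Q(x, x/ε) = div (R(x, x/ε)) - (div_x R)(x, x/ε)`.
Testing each equation with its own solution and adding, the exchange terms combine to
`-ε⁻¹ ∫ Q^ε w²` with `w = u₂ - u₁`. An integration by parts bounds this by
`C (‖w‖² + ‖w‖ ‖∇w‖)` with `C` independent of `ε` (`integral_osc_mul_testFunction` for test
functions, `exists_reaction_bound` for `H¹₀(Ω)`). The gradient is absorbed by the diffusion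
(`dissipation_le`), and Grönwall's inequality gives the claim (`bounds_of_energy_inequality`).

A weak solution is not an admissible test function, so the energy inequality has to be derived from
the weak form. By the du Bois-Reymond lemma (`ae_eq_primitive_of_weak_deriv`), the functional
`v ↦ ∫ c u(t) v` on `H¹₀(Ω)` is for almost every `t` the primitive of the functional `l(t)` given by
the other terms of the equation, with the initial value `v ↦ ∫ c g v`. By convexity,
`∫ c u(t)² - ∫ c u(s)² ≤ 2 ∫ c (u(t) - u(s)) u(t) = 2 (∫ₛᵗ l) (u(t))`, where `u(s) = g` and `l = 0`
for negative times. Taking `s = t - h`, integrating over `t`, dividing by `h` and letting `h → 0`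
gives the energy inequality (`energy_inequality`): the left side converges at Lebesgue points, the
right side because translations are continuous in `L²(ℝ)`. No regularity of the time derivative
beyond the weak form is used, and no chain rule is needed.
-/

noncomputable section

open Filter

namespace DualContinuum

/-! ### Sections of square integrable functions on a product -/

/-- A map into a second countable metric space is measurable as soon as its distances to all
points are: open sets are countable unions of balls. -/
theorem measurable_of_measurable_dist {α X : Type*} [MeasurableSpace α] [PseudoMetricSpace X]
    [SecondCountableTopology X] [MeasurableSpace X] [BorelSpace X] {f : α → X}
    (hf : ∀ x, Measurable fun a => dist (f a) x) : Measurable f := by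
  refine measurable_of_isOpen fun U hU => ?_
  choose! r hr hrU using Metric.isOpen_iff.1 hU
  obtain ⟨S, hSU, hS, hSeq⟩ := TopologicalSpace.isOpen_biUnion_countable U
    (fun x => Metric.ball x (r x)) fun _ _ => Metric.isOpen_ball
  have hUeq : U = ⋃ x ∈ S, Metric.ball x (r x) := by
    rw [hSeq]
    refine Subset.antisymm (fun x hx => mem_biUnion hx (Metric.mem_ball_self (hr x hx))) ?_
    exact iUnion₂_subset hrU
  rw [hUeq, preimage_iUnion₂]
  exact MeasurableSet.biUnion hS fun x _ => measurableSet_lt (hf x) measurable_const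

/-- Fubini for `L²`: a square integrable function on a product is a square integrable function of
the first variable with values in `L²` of the second one. -/
theorem exists_Lp_section {α β : Type*} [MeasurableSpace α] [MeasurableSpace β]
    {μ : Measure α} {ν : Measure β} [SFinite μ] [SFinite ν]
    [SecondCountableTopology (Lp ℝ 2 ν)]
    {q : α × β → ℝ} (hq : MemLp q 2 (μ.prod ν)) :
    ∃ Z : α → Lp ℝ 2 ν, MemLp Z 2 μ ∧ ∀ᵐ t ∂μ, Z t =ᵐ[ν] fun x => q (t, x) := by
  obtain ⟨f, hf, hqf⟩ := hq.1
  have hf2 : MemLp f 2 (μ.prod ν) := hq.ae_eq hqf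
  have hsec : ∀ t, AEStronglyMeasurable (fun x => f (t, x)) ν := fun t =>
    (hf.comp_measurable measurable_prodMk_left).aestronglyMeasurable
  have hnorm : ∀ g : Lp ℝ 2 ν, Measurable fun t => eLpNorm (fun x => f (t, x) - g x) 2 ν := by
    intro g
    simp only [eLpNorm_eq_lintegral_rpow_enorm_toReal (p := 2) (by simp) (by simp)]
    refine Measurable.pow_const ?_ _
    refine Measurable.lintegral_prod_right'
      (f := fun z : α × β => ‖f (z.1, z.2) - g z.2‖ₑ ^ (2 : ℝ≥0∞).toReal) ?_
    refine Measurable.pow_const ?_ _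
    exact (hf.measurable.sub ((Lp.stronglyMeasurable g).measurable.comp measurable_snd)).enorm
  have hnorm0 : Measurable fun t => eLpNorm (fun x => f (t, x)) 2 ν := by
    have h0 := hnorm 0
    convert! h0 using 2 with t
    refine eLpNorm_congr_ae ?_
    filter_upwards [Lp.coeFn_zero ℝ 2 ν] with x hx
    rw [hx, Pi.zero_apply, sub_zero]
  set S : Set α := {t | eLpNorm (fun x => f (t, x)) 2 ν < ⊤}
  have hS : MeasurableSet S := measurableSet_lt hnorm0 measurable_const
  classical
  let Z : α → Lp ℝ 2 ν := fun t =>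
    if h : MemLp (fun x => f (t, x)) 2 ν then h.toLp else 0
  have hSm : ∀ t, t ∈ S → MemLp (fun x => f (t, x)) 2 ν := fun t ht => ⟨hsec t, ht⟩
  have hZS : ∀ t (ht : t ∈ S), Z t = (hSm t ht).toLp := fun t ht => dif_pos _
  have hZS' : ∀ t, t ∉ S → Z t = 0 := fun t ht => dif_neg fun h => ht h.2
  let _ : MeasurableSpace (Lp ℝ 2 ν) := borel _
  have _ : BorelSpace (Lp ℝ 2 ν) := ⟨rfl⟩
  have hZmeas : Measurable Z := by
    refine measurable_of_measurable_dist fun g => ?_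
    have : (fun t => dist (Z t) g) = S.piecewise
        (fun t => (eLpNorm (fun x => f (t, x) - g x) 2 ν).toReal) (fun _ => dist 0 g) := by
      ext t
      by_cases ht : t ∈ S
      · rw [piecewise_eq_of_mem _ _ _ ht, hZS t ht, dist_edist, Lp.edist_def]
        congr 1
        refine eLpNorm_congr_ae ?_
        filter_upwards [(hSm t ht).coeFn_toLp] with x hx
        simp [hx]
      · rw [piecewise_eq_of_notMem _ _ _ ht, hZS' t ht]
    rw [this]
    exact (hnorm g).ennreal_toReal.piecewise hS measurable_const
  have hZnorm : ∀ t, ‖Z t‖ₑ ≤ eLpNorm (fun x => f (t, x)) 2 ν := by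
    intro t
    by_cases ht : t ∈ S
    · rw [hZS t ht, Lp.enorm_toLp]
    · simp [hZS' t ht]
  have hint : ∫⁻ z, ‖f z‖ₑ ^ (2 : ℝ) ∂(μ.prod ν) < ⊤ := by
    simpa using lintegral_rpow_enorm_lt_top_of_eLpNorm_lt_top (by simp) (by simp) hf2.2
  have hmeas2 : Measurable fun z => ‖f z‖ₑ ^ (2 : ℝ) := hf.measurable.enorm.pow_const _
  have hsq : ∀ t, ‖Z t‖ₑ ^ (2 : ℝ) ≤ ∫⁻ x, ‖f (t, x)‖ₑ ^ (2 : ℝ) ∂ν := by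
    intro t
    refine (ENNReal.rpow_le_rpow (hZnorm t) (by norm_num)).trans ?_
    rw [eLpNorm_eq_lintegral_rpow_enorm_toReal (p := 2) (by simp) (by simp), ← ENNReal.rpow_mul]
    simp
  refine ⟨Z, ⟨hZmeas.stronglyMeasurable.aestronglyMeasurable, ?_⟩, ?_⟩
  · refine (eLpNorm_lt_top_iff_lintegral_rpow_enorm_lt_top (by simp) (by simp)).2 ?_
    refine lt_of_le_of_lt ?_ hint
    rw [lintegral_prod _ hmeas2.aemeasurable]
    simpa using lintegral_mono hsq
  · have hfin : ∀ᵐ t ∂μ, t ∈ S := by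
      rw [lintegral_prod _ hmeas2.aemeasurable] at hint
      filter_upwards [ae_lt_top hmeas2.lintegral_prod_right' hint.ne] with t ht
      refine (eLpNorm_lt_top_iff_lintegral_rpow_enorm_lt_top (by simp) (by simp)).2 ?_
      simpa using ht
    filter_upwards [hfin, Measure.ae_ae_of_ae_prod hqf] with t ht hqt
    rw [hZS t ht]
    exact (hSm t ht).coeFn_toLp.trans (EventuallyEq.symm hqt)

/-! ### Integral identities and inequalities in time -/

/-- The du Bois-Reymond lemma with initial value: if `y' = ℓ`, `y(0) = G` in the weak sense on
`(0, T)`, then `y` is almost everywhere the primitive of `ℓ` with initial value `G`. -/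
theorem ae_eq_primitive_of_weak_deriv {D : Type*} [NormedAddCommGroup D] [NormedSpace ℝ D]
    [CompleteSpace D] {T : ℝ} (hT : 0 < T) {y l : ℝ → D}
    (hy : Integrable y (timeMeasure T)) (hl : Integrable l (timeMeasure T)) (G : D)
    (h : ∀ ψ : ℝ → ℝ, ContDiff ℝ 1 ψ → ψ T = 0 →
      -(∫ t in Ioo 0 T, deriv ψ t • y t) = (∫ t in Ioo 0 T, ψ t • l t) + ψ 0 • G) :
    ∀ᵐ t ∂timeMeasure T, y t = G + ∫ s in Ioo 0 t, l s := by
  set L : ℝ → D := fun t => ∫ s in Ioo 0 t, l s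
  have hLmem : ∀ t ∈ Ioo 0 T, L t = ∫ s in Ioo 0 T, (Iio t).indicator l s := by
    intro t ht
    rw [setIntegral_indicator measurableSet_Iio]
    show ∫ s in Ioo 0 t, l s = _
    congr 2
    ext s
    simp only [mem_Ioo, mem_inter_iff, mem_Iio]
    exact ⟨fun hs => ⟨⟨hs.1, hs.2.trans ht.2⟩, hs.2⟩, fun hs => ⟨hs.1.1, hs.2⟩⟩
  have hLbound : ∀ t ∈ Ioo 0 T, ‖L t‖ ≤ ∫ s in Ioo 0 T, ‖l s‖ := by
    intro t ht
    rw [hLmem t ht]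
    refine (norm_integral_le_integral_norm _).trans ?_
    refine integral_mono_of_nonneg (ae_of_all _ fun _ => norm_nonneg _) hl.norm
      (ae_of_all _ fun s => ?_)
    exact norm_indicator_le_norm_self _ _
  have hFint : ∀ η : ℝ → ℝ, Continuous η → Integrable (Function.uncurry fun s t : ℝ =>
      η s • (Iio s).indicator l t) ((timeMeasure T).prod (timeMeasure T)) := by
    intro η hη
    have hη1 : Integrable η (timeMeasure T) :=
      (hη.integrableOn_Icc (a := 0) (b := T)).mono_set Ioo_subset_Icc_self
    have h1 := hη1.smul_prod hl
    have h2 := h1.indicator (measurableSet_lt measurable_snd measurable_fst)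
    refine h2.congr (ae_of_all _ fun z => ?_)
    rcases z with ⟨s, t⟩
    by_cases hst : t < s <;> simp [indicator, hst]
  have hLint : Integrable L (timeMeasure T) := by
    refine ⟨?_, ?_⟩
    · have := (hFint (fun _ => 1) continuous_const).integral_prod_left.1
      refine this.congr ?_
      filter_upwards [ae_restrict_mem measurableSet_Ioo] with t ht
      simp [Function.uncurry, hLmem t ht]
    · refine HasFiniteIntegral.of_bounded (C := ∫ s in Ioo 0 T, ‖l s‖) ?_
      filter_upwards [ae_restrict_mem measurableSet_Ioo] with t ht using hLbound t ht
  have hz : Integrable (fun t => y t - (G + L t)) (timeMeasure T) :=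
    hy.sub ((integrable_const G).add hLint)
  have key : ∀ᵐ t ∂(volume : Measure ℝ), t ∈ Ioo 0 T → y t - (G + L t) = 0 := by
    refine isOpen_Ioo.ae_eq_zero_of_integral_contDiff_smul_eq_zero
      (IntegrableOn.locallyIntegrableOn hz) fun η hη hηc hηs => ?_
    have hηcont : Continuous η := hη.continuous
    have hder : ∀ t, HasDerivAt (fun t => ∫ s in T..t, η s) (η t) t := fun t =>
      intervalIntegral.integral_hasDerivAt_right (hηcont.intervalIntegrable _ _)
        (hηcont.stronglyMeasurableAtFilter _ _) hηcont.continuousAt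
    set ψ : ℝ → ℝ := fun t => ∫ s in T..t, η s
    have hderiv : deriv ψ = η := funext fun t => (hder t).deriv
    have hψ : ContDiff ℝ 1 ψ :=
      contDiff_one_iff_deriv.2 ⟨fun t => (hder t).differentiableAt, hderiv ▸ hηcont⟩
    have hψval : ∀ t ∈ Icc 0 T, ψ t = -∫ s in Ioo 0 T, (Ioi t).indicator η s := by
      intro t ht
      rw [setIntegral_indicator measurableSet_Ioi]
      show ∫ s in T..t, η s = _
      rw [intervalIntegral.integral_symm, intervalIntegral.integral_of_le ht.2,
        integral_Ioc_eq_integral_Ioo]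
      congr 3
      ext s
      simp only [mem_Ioo, mem_inter_iff, mem_Ioi]
      exact ⟨fun hs => ⟨⟨ht.1.trans_lt hs.1, hs.2⟩, hs.1⟩, fun hs => ⟨hs.2, hs.1.2⟩⟩
    have hψ0 : ψ 0 = -∫ s in Ioo 0 T, η s := by
      show ∫ s in T..0, η s = _
      rw [intervalIntegral.integral_symm, intervalIntegral.integral_of_le hT.le,
        integral_Ioc_eq_integral_Ioo]
    have hηint : Integrable η (timeMeasure T) :=
      (hηcont.integrableOn_Icc (a := 0) (b := T)).mono_set Ioo_subset_Icc_self
    -- Fubini on the triangle `0 < t < s < T` replaces the integration by parts.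
    have hswap : ∫ t in Ioo 0 T, ψ t • l t = -∫ s in Ioo 0 T, η s • L s := by
      have e1 : ∫ s in Ioo 0 T, η s • L s
          = ∫ s in Ioo 0 T, ∫ t in Ioo 0 T, η s • (Iio s).indicator l t := by
        refine setIntegral_congr_fun measurableSet_Ioo fun s hs => ?_
        simp only [hLmem s hs, integral_smul]
      rw [e1, integral_integral_swap (hFint η hηcont), ← integral_neg]
      refine setIntegral_congr_fun measurableSet_Ioo fun t ht => ?_
      simp only [hψval t (Ioo_subset_Icc_self ht), neg_smul, ← integral_smul_const]
      congr 1
      refine integral_congr_ae (ae_of_all _ fun s => ?_)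
      by_cases hst : t < s <;> simp [indicator, hst]
    have hw := h ψ hψ (by simp [ψ])
    rw [hderiv, hswap, hψ0] at hw
    have hbdd : ∃ C, ∀ t, ‖η t‖ ≤ C := hηc.exists_bound_of_continuous hηcont
    obtain ⟨C, hC⟩ := hbdd
    have i1 : Integrable (fun t => η t • y t) (timeMeasure T) :=
      hy.bdd_smul C hηcont.aestronglyMeasurable (ae_of_all _ hC)
    have i2 : Integrable (fun t => η t • L t) (timeMeasure T) :=
      hLint.bdd_smul C hηcont.aestronglyMeasurable (ae_of_all _ hC)
    have i3 : Integrable (fun t => η t • G) (timeMeasure T) := hηint.smul_const G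
    have hset : ∫ t, η t • (y t - (G + L t)) = ∫ t in Ioo 0 T, η t • (y t - (G + L t)) := by
      rw [setIntegral_eq_integral_of_forall_compl_eq_zero]
      intro t ht
      rw [image_eq_zero_of_notMem_tsupport fun h => ht (hηs h), zero_smul]
    rw [hset]
    have : ∀ t, η t • (y t - (G + L t)) = η t • y t - (η t • G + η t • L t) := fun t => by
      rw [smul_sub, smul_add]
    simp only [this]
    rw [integral_sub i1 (show Integrable (fun t => η t • G + η t • L t) (timeMeasure T) from
      i3.add i2), integral_add i3 i2, integral_smul_const]
    rw [neg_smul, ← neg_add, neg_inj] at hw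
    rw [hw]
    abel
  rw [ae_restrict_iff' measurableSet_Ioo]
  filter_upwards [key] with t ht htT
  exact sub_eq_zero.1 (ht htT)

/-- Translations are continuous in `L²(ℝ)`. -/
theorem tendsto_eLpNorm_sub_translate {D : Type*} [NormedAddCommGroup D] {l : ℝ → D}
    (hl : MemLp l 2 volume) :
    Tendsto (fun s : ℝ => eLpNorm (fun t => l (t - s) - l t) 2 volume) (𝓝 0) (𝓝 0) := by
  have : Fact ((2 : ℝ≥0∞) ≠ ⊤) := ⟨by simp⟩
  have hcont : Continuous fun s : ℝ => DomAddAct.mk (-s) +ᵥ hl.toLp :=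
    (DomAddAct.continuous_mk.comp continuous_neg).vadd continuous_const
  have h0 := (hcont.tendsto 0).edist (tendsto_const_nhds (x := hl.toLp))
  have hz : edist (DomAddAct.mk (-(0 : ℝ)) +ᵥ hl.toLp) hl.toLp = 0 := by
    rw [DomAddAct.mk_vadd_toLp, Lp.edist_toLp_toLp]
    simp
  rw [hz] at h0
  refine h0.congr fun s => ?_
  rw [DomAddAct.mk_vadd_toLp, Lp.edist_toLp_toLp]
  congr 1
  ext t
  simp [sub_eq_neg_add]

theorem lintegral_enorm_mul_le {D E : Type*} [NormedAddCommGroup D] [NormedAddCommGroup E]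
    {α : Type*} [MeasurableSpace α] {μ : Measure α}
    {f : α → D} {g : α → E} (hf : AEStronglyMeasurable f μ) (hg : AEStronglyMeasurable g μ) :
    ∫⁻ t, ‖f t‖ₑ * ‖g t‖ₑ ∂μ ≤ eLpNorm f 2 μ * eLpNorm g 2 μ := by
  have := ENNReal.lintegral_mul_le_Lp_mul_Lq μ Real.HolderConjugate.two_two hf.enorm hg.enorm
  simpa [eLpNorm_eq_lintegral_rpow_enorm_toReal] using this

theorem measurable_translate_mul {D E : Type*} [NormedAddCommGroup D] [NormedAddCommGroup E]
    {l : ℝ → D} {u : ℝ → E} (hlm : StronglyMeasurable l) (hum : StronglyMeasurable u) :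
    Measurable (Function.uncurry fun t s : ℝ => ‖l (t - s) - l t‖ₑ * ‖u t‖ₑ) := by
  have h1 : Measurable fun z : ℝ × ℝ => ‖l (z.1 - z.2) - l z.1‖ₑ :=
    ((hlm.comp_measurable (measurable_fst.sub measurable_snd)).sub
      (hlm.comp_measurable measurable_fst)).enorm
  have h2 : Measurable fun z : ℝ × ℝ => ‖u z.1‖ₑ := (hum.comp_measurable measurable_fst).enorm
  exact h1.mul h2

/-- The averages of `l` over `(t - h, t)` tend to `l` in `L²`; this is the form of that fact in
which the averages are paired with a fixed square integrable function. -/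
theorem eventually_lintegral_translate_le {D E : Type*} [NormedAddCommGroup D]
    [NormedAddCommGroup E] {l : ℝ → D} {u : ℝ → E} (hlm : StronglyMeasurable l)
    (hl : MemLp l 2 volume) (hum : StronglyMeasurable u) (hu : MemLp u 2 volume)
    {δ : ℝ} (hδ : 0 < δ) :
    ∀ᶠ h : ℝ in 𝓝[>] 0, ∫⁻ t, ∫⁻ s in Ioc 0 h, ‖l (t - s) - l t‖ₑ * ‖u t‖ₑ
      ≤ ENNReal.ofReal (h * δ) := by
  have hlim : Tendsto (fun s : ℝ => eLpNorm (fun t => l (t - s) - l t) 2 volume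
      * eLpNorm u 2 volume) (𝓝 0) (𝓝 0) := by
    simpa using ENNReal.Tendsto.mul_const (tendsto_eLpNorm_sub_translate hl)
      (Or.inr hu.2.ne)
  have hev := hlim.eventually_lt_const (ENNReal.ofReal_pos.2 hδ)
  obtain ⟨r, hr, hball⟩ := Metric.eventually_nhds_iff.1 hev
  filter_upwards [Ioo_mem_nhdsGT hr] with h hh
  have hmeas := measurable_translate_mul hlm hum
  rw [lintegral_lintegral_swap hmeas.aemeasurable]
  have hbound : ∀ s ∈ Ioc 0 h, ∫⁻ t, ‖l (t - s) - l t‖ₑ * ‖u t‖ₑ ≤ ENNReal.ofReal δ := by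
    intro s hs
    refine (lintegral_enorm_mul_le (f := fun t => l (t - s) - l t) ?_
      hum.aestronglyMeasurable).trans (hball ?_).le
    · exact ((hlm.comp_measurable (measurable_id.sub_const s)).sub hlm).aestronglyMeasurable
    · rw [Real.dist_eq, sub_zero, abs_of_pos hs.1]
      exact hs.2.trans_lt hh.2
  refine (setLIntegral_mono measurable_const hbound).trans ?_
  rw [setLIntegral_const, Real.volume_Ioc, sub_zero, mul_comm, ← ENNReal.ofReal_mul hh.1.le]

theorem integrable_of_memLp_two_of_eq_zero {D : Type*} [NormedAddCommGroup D] {l : ℝ → D}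
    (hl : MemLp l 2 volume) {a b : ℝ} (hl0 : ∀ t, t ∉ Ioo a b → l t = 0) :
    Integrable l volume := by
  have h1 : IntegrableOn l (Ioo a b) :=
    (hl.mono_measure Measure.restrict_le_self).integrable (by norm_num)
  exact h1.integrable_of_forall_notMem_eq_zero hl0

/-- The energy inequality for an abstract parabolic equation `(b u)' = l`, `u(0) = g`. Since `b`
is nonnegative, `b u(t) u(t) - b u(s) u(s) ≤ 2 b (u(t) - u(s)) u(t) = 2 (∫ₛᵗ l) (u(t))`, also for
`s ≤ 0` if `u` is continued by `g`. With `s = t - h`, integrated over `t ∈ (0, τ)` and divided by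
`h`, this gives the claim as `h → 0` at every Lebesgue point `τ` of `b u u`. -/
theorem energy_inequality {E X : Type*} [NormedAddCommGroup E] [NormedSpace ℝ E]
    [NormedAddCommGroup X] [NormedSpace ℝ X] (J : E →L[ℝ] X) (b : X →L[ℝ] X →L[ℝ] ℝ)
    (hsymm : ∀ x y, b x y = b y x) (hpos : ∀ x, 0 ≤ b x x) {T : ℝ}
    {u : ℝ → E} {l : ℝ → (E →L[ℝ] ℝ)} (hum : StronglyMeasurable u) (hu : MemLp u 2 volume)
    (hlm : StronglyMeasurable l) (hl : MemLp l 2 volume)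
    (hl0 : ∀ t, t ∉ Ioo 0 T → l t = 0) (g : X)
    (hweak : ∀ᵐ t ∂timeMeasure T, ∀ v,
      b (J (u t)) (J v) = b g (J v) + (∫ s in Ioo 0 t, l s) v) :
    ∀ᵐ t ∂timeMeasure T, b (J (u t)) (J (u t)) ≤ b g g + 2 * ∫ s in Ioo 0 t, l s (u s) := by
  have hlint : Integrable l volume := integrable_of_memLp_two_of_eq_zero hl hl0
  have hli : ∀ a c : ℝ, IntervalIntegrable l volume a c := fun a c => hlint.intervalIntegrable
  have hluint : Integrable (fun t => l t (u t)) volume :=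
    memLp_one_iff_integrable.1
      ((ContinuousLinearMap.id ℝ (E →L[ℝ] ℝ)).memLp_of_bilin 1 hl hu)
  have hbuint : Integrable (fun t => b (J (u t)) (J (u t))) volume :=
    memLp_one_iff_integrable.1 (b.memLp_of_bilin 1 (J.comp_memLp' hu) (J.comp_memLp' hu))
  set y : ℝ → (E →L[ℝ] ℝ) := fun t => ∫ s in (0 : ℝ)..t, l s with hy
  have hy_nonpos : ∀ t ≤ 0, y t = 0 := by
    intro t ht
    show ∫ s in (0 : ℝ)..t, l s = 0
    rw [intervalIntegral.integral_symm, intervalIntegral.integral_of_le ht,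
      setIntegral_eq_zero_of_forall_eq_zero, neg_zero]
    exact fun s hs => hl0 s fun h => absurd h.1 hs.2.not_gt
  set φ : ℝ → ℝ := fun t => if t ≤ 0 then b g g else b (J (u t)) (J (u t)) with hφ
  have hφint : LocallyIntegrable φ volume := by
    have : φ = fun t => (Iic 0).indicator (fun _ => b g g) t
        + (Ioi 0).indicator (fun t => b (J (u t)) (J (u t))) t := by
      ext t
      by_cases ht : t ≤ 0 <;> simp [hφ, ht, indicator]
    rw [this]
    refine LocallyIntegrable.add ?_ (hbuint.indicator measurableSet_Ioi).locallyIntegrable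
    exact (locallyIntegrable_const _).indicator measurableSet_Iic
  have hφi : ∀ a c : ℝ, IntervalIntegrable φ volume a c := fun a c =>
    (hφint.integrableOn_isCompact isCompact_uIcc).intervalIntegrable
  rw [ae_restrict_iff' measurableSet_Ioo] at hweak
  -- The state at a time `t < T`, continued by `g` to negative times.
  have hstate : ∀ᵐ t : ℝ, t < T → ∃ x : X, φ t = b x x ∧ (0 < t → x = J (u t)) ∧
      ∀ v, b x (J v) = b g (J v) + y t v := by
    filter_upwards [hweak] with t ht htT
    by_cases h : t ≤ 0
    · exact ⟨g, by simp [hφ, h], fun h' => absurd h' h.not_gt, fun v => by simp [hy_nonpos t h]⟩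
    · push Not at h
      refine ⟨J (u t), by simp [hφ, h.not_ge], fun _ => rfl, fun v => ?_⟩
      rw [ht ⟨h, htT⟩ v, hy]
      simp only [intervalIntegral.integral_of_le h.le, integral_Ioc_eq_integral_Ioo]
  have hstep : ∀ h > 0, ∀ᵐ t : ℝ, t ∈ Ioo 0 T →
      φ t - φ (t - h) ≤ 2 * (y t - y (t - h)) (u t) := by
    intro h hh
    have hshift := (measurePreserving_sub_right volume h).quasiMeasurePreserving.ae hstate
    filter_upwards [hstate, hshift] with t h1 h2 ht
    obtain ⟨x, hx, hxu, hxv⟩ := h1 ht.2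
    obtain ⟨z, hz, -, hzv⟩ := h2 (by linarith [ht.2])
    have hxu := hxu ht.1
    subst hxu
    have hp := hpos (J (u t) - z)
    simp only [map_sub, sub_apply] at hp
    rw [hx, hz, sub_apply]
    have e1 := hxv (u t)
    have e2 := hzv (u t)
    have e3 := hsymm (J (u t)) z
    linarith
  -- The increment of `y`, compared with `h • l t`.
  have hincr : ∀ h > 0, ∀ t, ∫⁻ s in Ioc 0 h, ‖l (t - s) - l t‖ₑ * ‖u t‖ₑ < ⊤ →
      (y t - y (t - h)) (u t)
        ≤ h * l t (u t) + (∫⁻ s in Ioc 0 h, ‖l (t - s) - l t‖ₑ * ‖u t‖ₑ).toReal := by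
    intro h hh t hfin
    have hls : IntervalIntegrable (fun s => l (t - s)) volume 0 h :=
      (hlint.comp_sub_left t).intervalIntegrable
    have e1 : y t - y (t - h) = ∫ s in (0 : ℝ)..h, l (t - s) := by
      rw [intervalIntegral.integral_comp_sub_left, sub_zero, hy]
      exact intervalIntegral.integral_interval_sub_left (hli _ _) (hli _ _)
    have e2 : (y t - y (t - h)) (u t) - h * l t (u t)
        = ∫ s in (0 : ℝ)..h, (l (t - s) - l t) (u t) := by
      rw [← ContinuousLinearMap.intervalIntegral_apply (hls.sub intervalIntegrable_const),
        intervalIntegral.integral_sub hls intervalIntegrable_const, e1]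
      simp
    have e3 : ‖∫ s in (0 : ℝ)..h, (l (t - s) - l t) (u t)‖ₑ
        ≤ ∫⁻ s in Ioc 0 h, ‖l (t - s) - l t‖ₑ * ‖u t‖ₑ := by
      rw [intervalIntegral.integral_of_le hh.le]
      refine (enorm_integral_le_lintegral_enorm _).trans (lintegral_mono fun s => ?_)
      exact ContinuousLinearMap.le_opENorm _ _
    have e4 := ENNReal.toReal_mono hfin.ne e3
    rw [toReal_enorm, Real.norm_eq_abs] at e4
    have e5 := (le_abs_self _).trans e4
    linarith
  have hmeas := measurable_translate_mul hlm hum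
  rw [ae_restrict_iff' measurableSet_Ioo]
  filter_upwards [LocallyIntegrable.ae_hasDerivAt_integral hφint] with τ hτ hτT
  have hφτ : φ τ = b (J (u τ)) (J (u τ)) := by simp [hφ, hτT.1.not_ge]
  rw [← hφτ]
  refine le_of_forall_pos_le_add fun δ hδ => ?_
  set Φ : ℝ → ℝ := fun x => ∫ t in (0 : ℝ)..x, φ t with hΦ
  have hΦneg : ∀ h > 0, Φ (-h) = -(h * b g g) := by
    intro h hh
    show ∫ t in (0 : ℝ)..(-h), φ t = _
    have : ∫ t in (0 : ℝ)..(-h), φ t = ∫ t in (0 : ℝ)..(-h), b g g := by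
      refine intervalIntegral.integral_congr fun t ht => ?_
      rw [uIcc_of_ge (by linarith)] at ht
      simp [hφ, ht.2]
    rw [this]
    simp
  have hev : ∀ᶠ h : ℝ in 𝓝[>] 0,
      h⁻¹ * (Φ τ - Φ (τ - h)) ≤ b g g + 2 * (∫ s in Ioo 0 τ, l s (u s)) + δ := by
    filter_upwards [eventually_lintegral_translate_le hlm hl hum hu (half_pos hδ),
      self_mem_nhdsWithin] with h hle hh
    have hh : 0 < h := hh
    set e : ℝ → ℝ≥0∞ := fun t => ∫⁻ s in Ioc 0 h, ‖l (t - s) - l t‖ₑ * ‖u t‖ₑ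
    have hem : Measurable e := hmeas.lintegral_prod_right'
    have hefin : ∫⁻ t, e t ≠ ⊤ := (hle.trans_lt ENNReal.ofReal_lt_top).ne
    have heint : Integrable (fun t => (e t).toReal) volume :=
      integrable_toReal_of_lintegral_ne_top hem.aemeasurable hefin
    have heval : ∫ t in (0 : ℝ)..τ, (e t).toReal ≤ h * (δ / 2) := by
      rw [intervalIntegral.integral_of_le hτT.1.le]
      refine (setIntegral_le_integral heint (ae_of_all _ fun _ => ENNReal.toReal_nonneg)).trans ?_
      rw [integral_toReal hem.aemeasurable (ae_lt_top hem hefin)]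
      exact ENNReal.toReal_le_of_le_ofReal (by positivity) hle
    have hi : IntervalIntegrable (fun t => φ (t - h)) volume 0 τ := by
      simpa using (hφi (0 - h) (τ - h)).comp_sub_right h (by simp)
    have hri : Integrable (fun t => 2 * (h * l t (u t) + (e t).toReal)) volume :=
      ((hluint.const_mul h).add heint).const_mul 2
    have hmono : ∫ t in (0 : ℝ)..τ, (φ t - φ (t - h))
        ≤ ∫ t in (0 : ℝ)..τ, 2 * (h * l t (u t) + (e t).toReal) := by
      simp only [intervalIntegral.integral_of_le hτT.1.le]
      refine setIntegral_mono_on_ae ((hφi _ _).sub hi).1 hri.integrableOn measurableSet_Ioc ?_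
      filter_upwards [hstep h hh, ae_lt_top hem hefin] with t h1 h2 ht
      exact (h1 ⟨ht.1, ht.2.trans_lt hτT.2⟩).trans
        (mul_le_mul_of_nonneg_left (hincr h hh t h2) zero_le_two)
    rw [intervalIntegral.integral_sub (hφi _ _) hi,
      intervalIntegral.integral_comp_sub_right, intervalIntegral.integral_const_mul,
      intervalIntegral.integral_add (hluint.const_mul h).intervalIntegrable
        heint.intervalIntegrable, intervalIntegral.integral_const_mul,
      intervalIntegral.integral_of_le hτT.1.le (f := fun t => l t (u t)),
      integral_Ioc_eq_integral_Ioo] at hmono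
    have hadj : ∫ t in (0 - h)..(τ - h), φ t = Φ (τ - h) - Φ (-h) := by
      rw [zero_sub]
      exact (intervalIntegral.integral_interval_sub_left (hφi _ _) (hφi _ _)).symm
    rw [hadj, hΦneg h hh] at hmono
    have hfold : ∫ t in (0 : ℝ)..τ, φ t = Φ τ := rfl
    rw [hfold] at hmono
    rw [inv_mul_le_iff₀ hh]
    linarith
  have hder : HasDerivAt (fun h => Φ τ - Φ (τ - h)) (φ τ) 0 := by
    have h1 : HasDerivAt (fun h : ℝ => τ - h) (-1) 0 := by
      simpa using (hasDerivAt_id (0 : ℝ)).const_sub τ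
    have h2 : HasDerivAt Φ (φ τ) (τ - 0) := by simpa using hτ 0
    simpa using (h2.comp 0 h1).const_sub (Φ τ)
  have hlim := (hasDerivAt_iff_tendsto_slope_zero.1 hder).mono_left
    (nhdsWithin_mono (0 : ℝ) (fun h (hh : h ∈ Ioi (0 : ℝ)) => (ne_of_gt hh : h ≠ 0)))
  refine le_of_tendsto hlim (hev.mono fun h hh => ?_)
  simpa using hh

theorem integrable_continuous_smul {D : Type*} [NormedAddCommGroup D] [NormedSpace ℝ D] {T : ℝ}
    {η : ℝ → ℝ} {f : ℝ → D} (hη : Continuous η) (hf : Integrable f (timeMeasure T)) :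
    Integrable (fun t => η t • f t) (timeMeasure T) := by
  obtain ⟨C, hC⟩ := isCompact_Icc.exists_bound_of_continuousOn (s := Icc 0 T) hη.continuousOn
  refine hf.bdd_smul C hη.aestronglyMeasurable ?_
  filter_upwards [ae_restrict_mem measurableSet_Ioo] with t ht
  exact hC t (Ioo_subset_Icc_self ht)

theorem exists_extension_by_zero {D : Type*} [NormedAddCommGroup D] {T : ℝ} {f : ℝ → D}
    (hf : MemLp f 2 (timeMeasure T)) :
    ∃ f' : ℝ → D, StronglyMeasurable f' ∧ MemLp f' 2 volume ∧ (∀ t, t ∉ Ioo 0 T → f' t = 0) ∧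
      f =ᵐ[timeMeasure T] f' :=
  ⟨(Ioo 0 T).indicator (hf.1.mk f), hf.1.stronglyMeasurable_mk.indicator measurableSet_Ioo,
    (memLp_indicator_iff_restrict measurableSet_Ioo).2 (hf.ae_eq hf.1.ae_eq_mk),
    fun _ ht => indicator_of_notMem ht _,
    hf.1.ae_eq_mk.trans (indicator_ae_eq_restrict measurableSet_Ioo).symm⟩

/-- The energy inequality for the weak form, tested with `ψ(t) v`, of an abstract parabolic
equation `(b u)' = l`, `u(0) = g` on `(0, T)`. -/
theorem weak_energy_inequality {E X : Type*} [NormedAddCommGroup E] [NormedSpace ℝ E]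
    [NormedAddCommGroup X] [NormedSpace ℝ X] (J : E →L[ℝ] X) (b : X →L[ℝ] X →L[ℝ] ℝ)
    (hsymm : ∀ x y, b x y = b y x) (hpos : ∀ x, 0 ≤ b x x) {T : ℝ} (hT : 0 < T)
    {u : ℝ → E} {l : ℝ → (E →L[ℝ] ℝ)} (hu : MemLp u 2 (timeMeasure T))
    (hl : MemLp l 2 (timeMeasure T)) (g : X)
    (hweak : ∀ (v : E) (ψ : ℝ → ℝ), ContDiff ℝ 1 ψ → ψ T = 0 →
      -(∫ t in Ioo 0 T, deriv ψ t * b (J (u t)) (J v))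
        = (∫ t in Ioo 0 T, ψ t * l t v) + ψ 0 * b g (J v)) :
    ∀ᵐ t ∂timeMeasure T, b (J (u t)) (J (u t)) ≤ b g g + 2 * ∫ s in Ioo 0 t, l s (u s) := by
  obtain ⟨A, hA⟩ : ∃ A : E →L[ℝ] E →L[ℝ] ℝ, ∀ x y, A x y = b (J x) (J y) :=
    ⟨b.bilinearComp J J, fun _ _ => rfl⟩
  have hAu : Integrable (fun t => A (u t)) (timeMeasure T) :=
    (A.comp_memLp' hu).integrable (by norm_num)
  have hli : Integrable l (timeMeasure T) := hl.integrable (by norm_num)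
  have hprim := ae_eq_primitive_of_weak_deriv hT hAu hli ((b g).comp J) (by
    intro ψ hψ hψT
    have hψ' : Continuous (deriv ψ) := (contDiff_one_iff_deriv.1 hψ).2
    ext v
    have h1 := ContinuousLinearMap.integral_apply (integrable_continuous_smul hψ' hAu) v
    have h2 := ContinuousLinearMap.integral_apply (integrable_continuous_smul hψ.continuous hli) v
    have h3 := hweak v ψ hψ hψT
    simp only [neg_apply, add_apply, smul_apply, smul_eq_mul, h1, h2]
    simpa [hA] using h3)
  obtain ⟨u', hum, hu2, -, huu'⟩ := exists_extension_by_zero hu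
  obtain ⟨l', hlm, hl2, hl0, hll'⟩ := exists_extension_by_zero hl
  have hsub : ∀ {p : ℝ → Prop}, (∀ᵐ t ∂timeMeasure T, p t) → ∀ t ≤ T,
      ∀ᵐ s ∂volume.restrict (Ioo 0 t), p s := fun hp t ht =>
    ae_restrict_of_ae_restrict_of_subset (Ioo_subset_Ioo_right ht) hp
  have hprim' : ∀ᵐ t ∂timeMeasure T, ∀ v,
      b (J (u' t)) (J v) = b g (J v) + (∫ s in Ioo 0 t, l' s) v := by
    filter_upwards [hprim, huu', ae_restrict_mem measurableSet_Ioo] with t ht htu htT v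
    have h1 : ∫ s in Ioo 0 t, l' s = ∫ s in Ioo 0 t, l s :=
      integral_congr_ae (hsub (hll'.mono fun _ h => h.symm) t htT.2.le)
    rw [h1, ← htu, ← hA, ht]
    rfl
  have key := energy_inequality J b hsymm hpos hum hu2 hlm hl2 (fun t ht => hl0 t ht) g hprim'
  filter_upwards [key, huu', ae_restrict_mem measurableSet_Ioo] with t ht htu htT
  have h1 : ∫ s in Ioo 0 t, l' s (u' s) = ∫ s in Ioo 0 t, l s (u s) := by
    refine integral_congr_ae ?_
    filter_upwards [hsub hll' t htT.2.le, hsub huu' t htT.2.le] with s h2 h3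
    rw [h2, h3]
  rw [← htu, h1] at ht
  exact ht

/-- An upper bound on `(0, T)` for every nonnegative `N` with `N(t) ≤ A + B ∫₀ᵗ N`; the value of
`gronwallBound` in it bounds the second primitive of `N`. -/
def gronwallConst (T A B : ℝ) : ℝ := A + B * (A * T + B * gronwallBound 0 B (A * T) T)

/-- Grönwall's inequality in integral form for an integrable function; the classical differential
form is applied to the second primitive. -/
theorem ae_le_gronwallConst {T A B : ℝ} (hT : 0 < T) (hA : 0 ≤ A) (hB : 0 ≤ B) {N : ℝ → ℝ}
    (hN : Integrable N (timeMeasure T)) (hpos : ∀ t, 0 ≤ N t)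
    (h : ∀ᵐ t ∂timeMeasure T, N t ≤ A + B * ∫ s in Ioo 0 t, N s) :
    ∀ᵐ t ∂timeMeasure T, N t ≤ gronwallConst T A B := by
  have hN' : Integrable ((Ioo 0 T).indicator N) volume :=
    (integrable_indicator_iff measurableSet_Ioo).2 hN
  set I : ℝ → ℝ := fun t => ∫ s in (0 : ℝ)..t, (Ioo 0 T).indicator N s with hI
  have hIcont : Continuous I := intervalIntegral.continuous_primitive
    (fun _ _ => hN'.intervalIntegrable) 0
  have hIeq : ∀ t ∈ Icc 0 T, I t = ∫ s in Ioo 0 t, N s := by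
    intro t ht
    simp only [hI]
    rw [intervalIntegral.integral_of_le ht.1, integral_Ioc_eq_integral_Ioo]
    exact setIntegral_congr_fun measurableSet_Ioo fun s hs =>
      indicator_of_mem (show s ∈ Ioo 0 T from ⟨hs.1, hs.2.trans_le ht.2⟩) _
  have hInn : ∀ t ∈ Icc 0 T, 0 ≤ I t := fun t ht => by
    rw [hIeq t ht]
    exact integral_nonneg hpos
  set M : ℝ → ℝ := fun t => ∫ s in (0 : ℝ)..t, I s with hM
  have hMder : ∀ t, HasDerivAt M (I t) t := fun t =>
    intervalIntegral.integral_hasDerivAt_right (hIcont.intervalIntegrable _ _)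
      (hIcont.stronglyMeasurableAtFilter _ _) hIcont.continuousAt
  have hMnn : ∀ t ∈ Icc 0 T, 0 ≤ M t := fun t ht =>
    intervalIntegral.integral_nonneg ht.1 fun s hs => hInn s ⟨hs.1, hs.2.trans ht.2⟩
  have hIM : ∀ t ∈ Icc 0 T, I t ≤ B * M t + A * T := by
    intro t ht
    have h1 : I t ≤ ∫ s in Ioo 0 t, (A + B * I s) := by
      rw [hIeq t ht]
      refine setIntegral_mono_on_ae ?_ ?_ measurableSet_Ioo ?_
      · exact IntegrableOn.mono_set hN (Ioo_subset_Ioo_right ht.2)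
      · exact ((continuous_const.add (hIcont.const_mul B)).integrableOn_Icc).mono_set
          Ioo_subset_Icc_self
      · rw [ae_restrict_iff' measurableSet_Ioo] at h
        filter_upwards [h] with s hs hst
        have hsT : s ∈ Ioo 0 T := ⟨hst.1, hst.2.trans_le ht.2⟩
        rw [hIeq s (Ioo_subset_Icc_self hsT)]
        exact hs hsT
    have h2 : ∫ s in Ioo 0 t, (A + B * I s) = A * t + B * M t := by
      rw [← integral_Ioc_eq_integral_Ioo, ← intervalIntegral.integral_of_le ht.1,
        intervalIntegral.integral_add intervalIntegrable_const
          ((hIcont.const_mul B).intervalIntegrable _ _), intervalIntegral.integral_const_mul]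
      simp [hM, mul_comm]
    have h3 : A * t ≤ A * T := mul_le_mul_of_nonneg_left ht.2 hA
    linarith
  have hMb : ∀ t ∈ Icc 0 T, M t ≤ gronwallBound 0 B (A * T) T := by
    intro t ht
    have h1 := norm_le_gronwallBound_of_norm_deriv_right_le (f := M) (f' := I) (δ := 0) (K := B)
      (ε := A * T) (a := 0) (b := T) (fun s _ => (hMder s).continuousAt.continuousWithinAt)
      (fun s _ => (hMder s).hasDerivWithinAt) (by simp [hM]) (fun s hs => by
        have hs' : s ∈ Icc 0 T := Ico_subset_Icc_self hs
        rw [Real.norm_of_nonneg (hInn s hs'), Real.norm_of_nonneg (hMnn s hs')]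
        exact hIM s hs') t ht
    rw [Real.norm_of_nonneg (hMnn t ht), sub_zero] at h1
    exact h1.trans (gronwallBound_mono le_rfl (by positivity) hB ht.2)
  filter_upwards [h, ae_restrict_mem measurableSet_Ioo] with t ht htT
  have htT' := Ioo_subset_Icc_self htT
  rw [← hIeq t htT'] at ht
  refine ht.trans ?_
  unfold gronwallConst
  have h1 := hIM t htT'
  have h2 := mul_le_mul_of_nonneg_left (hMb t htT') hB
  have h3 := mul_le_mul_of_nonneg_left (h1.trans (add_le_add_left h2 _)) hB
  linarith

/-! ### Weighted inner products on `L²` -/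

theorem integral_norm_mul_norm_le {α E F : Type*} [MeasurableSpace α] {μ : Measure α}
    [NormedAddCommGroup E] [NormedAddCommGroup F] (f : Lp E 2 μ) (g : Lp F 2 μ) :
    ∫ x, ‖f x‖ * ‖g x‖ ∂μ ≤ ‖f‖ * ‖g‖ := by
  have h1 : ‖∫ x, ‖f x‖ * ‖g x‖ ∂μ‖ₑ ≤ ‖f‖ₑ * ‖g‖ₑ := by
    refine (enorm_integral_le_lintegral_enorm _).trans ?_
    simp only [enorm_mul, enorm_norm, Lp.enorm_def]
    exact lintegral_enorm_mul_le (Lp.aestronglyMeasurable f) (Lp.aestronglyMeasurable g)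
  have h2 := ENNReal.toReal_mono (by finiteness) h1
  rw [toReal_enorm, ENNReal.toReal_mul, toReal_enorm, toReal_enorm] at h2
  exact (le_abs_self _).trans h2

theorem integrable_weight_mul_inner {α F : Type*} [MeasurableSpace α] [NormedAddCommGroup F]
    [InnerProductSpace ℝ F] {μ : Measure α} {c : α → ℝ} {M : ℝ} (hc : AEStronglyMeasurable c μ)
    (hM : ∀ᵐ x ∂μ, |c x| ≤ M) (f g : Lp F 2 μ) :
    Integrable (fun x => c x * inner ℝ (f x) (g x)) μ :=
  (L2.integrable_inner (𝕜 := ℝ) f g).bdd_mul hc hM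

/-- The bilinear form `∫ c ⟪f, g⟫` on `L²` for a bounded weight `c`. -/
theorem exists_weighted_form {α F : Type*} [MeasurableSpace α] [NormedAddCommGroup F]
    [InnerProductSpace ℝ F] {μ : Measure α} {c : α → ℝ} {M : ℝ} (hc : AEStronglyMeasurable c μ)
    (hM0 : 0 ≤ M) (hM : ∀ᵐ x ∂μ, |c x| ≤ M) :
    ∃ b : Lp F 2 μ →L[ℝ] Lp F 2 μ →L[ℝ] ℝ,
      (∀ f g, b f g = ∫ x, c x * inner ℝ (f x) (g x) ∂μ) ∧ ∀ f g, |b f g| ≤ M * ‖f‖ * ‖g‖ := by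
  have hint := fun f g : Lp F 2 μ => integrable_weight_mul_inner hc hM f g
  let B : Lp F 2 μ →ₗ[ℝ] Lp F 2 μ →ₗ[ℝ] ℝ :=
    LinearMap.mk₂ ℝ (fun f g => ∫ x, c x * inner ℝ (f x) (g x) ∂μ)
      (fun f f' g => by
        rw [← integral_add (hint f g) (hint f' g)]
        refine integral_congr_ae ?_
        filter_upwards [Lp.coeFn_add f f'] with x hx
        rw [hx, Pi.add_apply, inner_add_left, mul_add])
      (fun a f g => by
        rw [smul_eq_mul, ← integral_const_mul]
        refine integral_congr_ae ?_
        filter_upwards [Lp.coeFn_smul a f] with x hx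
        rw [hx, Pi.smul_apply, real_inner_smul_left]
        ring)
      (fun f g g' => by
        rw [← integral_add (hint f g) (hint f g')]
        refine integral_congr_ae ?_
        filter_upwards [Lp.coeFn_add g g'] with x hx
        rw [hx, Pi.add_apply, inner_add_right, mul_add])
      (fun a f g => by
        rw [smul_eq_mul, ← integral_const_mul]
        refine integral_congr_ae ?_
        filter_upwards [Lp.coeFn_smul a g] with x hx
        rw [hx, Pi.smul_apply, real_inner_smul_right]
        ring)
  have hB : ∀ f g, ‖B f g‖ ≤ M * ‖f‖ * ‖g‖ := by
    intro f g
    have hfg : Integrable (fun x => ‖f x‖ * ‖g x‖) μ :=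
      (Lp.memLp f).norm.integrable_mul (Lp.memLp g).norm
    refine (norm_integral_le_of_norm_le (hfg.const_mul M) ?_).trans ?_
    · filter_upwards [hM] with x hx
      rw [norm_mul]
      exact mul_le_mul hx (norm_inner_le_norm _ _) (norm_nonneg _) hM0
    · rw [integral_const_mul, mul_assoc]
      exact mul_le_mul_of_nonneg_left (integral_norm_mul_norm_le f g) hM0
  exact ⟨B.mkContinuous₂ M hB, fun f g => rfl, hB⟩

theorem mul_norm_sq_le_integral_weight {α F : Type*} [MeasurableSpace α] [NormedAddCommGroup F]
    [InnerProductSpace ℝ F] {μ : Measure α} {c : α → ℝ} {m M : ℝ} (hc : AEStronglyMeasurable c μ)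
    (hM : ∀ᵐ x ∂μ, |c x| ≤ M) (hm : ∀ᵐ x ∂μ, m ≤ c x) (f : Lp F 2 μ) :
    m * ‖f‖ ^ 2 ≤ ∫ x, c x * inner ℝ (f x) (f x) ∂μ := by
  rw [← real_inner_self_eq_norm_sq, L2.inner_def, ← integral_const_mul]
  refine integral_mono_ae ((L2.integrable_inner (𝕜 := ℝ) f f).const_mul m)
    (integrable_weight_mul_inner hc hM f f) ?_
  filter_upwards [hm] with x hx
  exact mul_le_mul_of_nonneg_right hx real_inner_self_nonneg

/-! ### The space `H¹₀(Ω)` -/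

/-- The map `v ↦ v` from `H¹₀(Ω)` to `L²(Ω)`. -/
def V.fnL {d : ℕ} (Ω : Set (Sp d)) : V Ω →L[ℝ] H Ω :=
  (WithLp.fstL 2 ℝ (H Ω) (HVec Ω)).comp (V Ω).subtypeL

/-- The weak gradient as a map from `H¹₀(Ω)` to `L²(Ω)^d`. -/
def V.gradL {d : ℕ} (Ω : Set (Sp d)) : V Ω →L[ℝ] HVec Ω :=
  (WithLp.sndL 2 ℝ (H Ω) (HVec Ω)).comp (V Ω).subtypeL

theorem V.fnL_apply {d : ℕ} {Ω : Set (Sp d)} (v : V Ω) : V.fnL Ω v = V.fn v := rfl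

theorem V.norm_sq_eq {d : ℕ} {Ω : Set (Sp d)} (v : V Ω) :
    ‖v‖ ^ 2 = ‖V.fn v‖ ^ 2 + ‖V.grad v‖ ^ 2 :=
  WithLp.prod_norm_sq_eq_of_L2 (v : WithLp 2 (H Ω × HVec Ω))

theorem gradient_add_eq {d : ℕ} {f g : Sp d → ℝ} {x : Sp d} (hf : DifferentiableAt ℝ f x)
    (hg : DifferentiableAt ℝ g x) :
    gradient (fun x => f x + g x) x = gradient f x + gradient g x := by
  have := fderiv_add hf hg
  simp only [gradient]
  rw [← map_add, ← this]
  rfl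

theorem gradient_const_smul_eq {d : ℕ} {f : Sp d → ℝ} {x : Sp d} (a : ℝ)
    (hf : DifferentiableAt ℝ f x) :
    gradient (fun x => a * f x) x = a • gradient f x := by
  have := fderiv_const_smul hf a
  simp only [gradient]
  rw [← map_smul, ← this]
  rfl

/-- An inequality between the components of `H¹₀` functions that is stable under limits holds as
soon as it holds for test functions. -/
theorem V.induction_testFunction {d : ℕ} {Ω : Set (Sp d)} {p : H Ω → HVec Ω → Prop}
    (hp : IsClosed {w : WithLp 2 (H Ω × HVec Ω) | p w.fst w.snd})
    (htest : ∀ (φ : Sp d → ℝ) (f : H Ω) (F : HVec Ω), IsTestFunction Ω φ →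
      f =ᵐ[spaceMeasure Ω] φ → F =ᵐ[spaceMeasure Ω] (fun x => gradient φ x) → p f F)
    (v : V Ω) : p (V.fn v) (V.grad v) := by
  refine closure_minimal (fun w hw => ?_) hp v.2
  have hw' : ∃ φ : Sp d → ℝ, IsTestFunction Ω φ ∧ w.fst =ᵐ[spaceMeasure Ω] φ ∧
      w.snd =ᵐ[spaceMeasure Ω] fun x => gradient φ x := by
    refine Submodule.span_induction (p := fun w _ => ∃ φ : Sp d → ℝ, IsTestFunction Ω φ ∧
      w.fst =ᵐ[spaceMeasure Ω] φ ∧ w.snd =ᵐ[spaceMeasure Ω] fun x => gradient φ x)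
      (fun w hw => hw) ?_ ?_ ?_ hw
    · refine ⟨fun _ => 0, ⟨contDiff_const, HasCompactSupport.zero, ?_⟩, ?_, ?_⟩
      · simp [tsupport]
      · exact Lp.coeFn_zero _ _ _
      · filter_upwards [Lp.coeFn_zero (Sp d) 2 (spaceMeasure Ω)] with x hx
        rw [gradient_fun_const]
        exact hx
    · rintro w z - - ⟨φ, hφ, hw1, hw2⟩ ⟨χ, hχ, hz1, hz2⟩
      refine ⟨fun x => φ x + χ x, ⟨hφ.smooth.add hχ.smooth, hφ.compact.add hχ.compact, ?_⟩, ?_, ?_⟩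
      · exact (tsupport_add φ χ).trans (union_subset hφ.support hχ.support)
      · filter_upwards [Lp.coeFn_add w.fst z.fst, hw1, hz1] with x h1 h2 h3
        rw [WithLp.add_fst, h1, Pi.add_apply, h2, h3]
      · filter_upwards [Lp.coeFn_add w.snd z.snd, hw2, hz2] with x h1 h2 h3
        rw [WithLp.add_snd, h1, Pi.add_apply, h2, h3, gradient_add_eq
          ((hφ.smooth.differentiable (by simp)) x) ((hχ.smooth.differentiable (by simp)) x)]
    · rintro a w - ⟨φ, hφ, hw1, hw2⟩
      refine ⟨fun x => a * φ x, ⟨contDiff_const.mul hφ.smooth, hφ.compact.mul_left, ?_⟩, ?_, ?_⟩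
      · exact (closure_mono (Function.support_mul_subset_right _ _)).trans hφ.support
      · filter_upwards [Lp.coeFn_smul a w.fst, hw1] with x h1 h2
        rw [WithLp.smul_fst, h1, Pi.smul_apply, h2, smul_eq_mul]
      · filter_upwards [Lp.coeFn_smul a w.snd, hw2] with x h1 h2
        rw [WithLp.smul_snd, h1, Pi.smul_apply, h2, gradient_const_smul_eq _
          ((hφ.smooth.differentiable (by simp)) x)]
  obtain ⟨φ, hφ, h1, h2⟩ := hw'
  exact htest φ _ _ hφ h1 h2

/-! ### Integration by parts for the oscillating coefficient -/

/-- The chain rule for `x ↦ F(x, x / ε)` along a line. Differentiability of `F` in `x`, as a map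
into bounded continuous functions, is uniform in `y`, which allows the point of evaluation to
move. -/
theorem hasLineDerivAt_eval_smul {d : ℕ} {F : Sp d → (Sp d →ᵇ Sp d)}
    {F' : Sp d →L[ℝ] (Sp d →ᵇ Sp d)} {G : Sp d →L[ℝ] Sp d} {x : Sp d} {a : ℝ} (hF : HasFDerivAt F F' x)
    (hG : HasFDerivAt (F x) G (a • x)) (e : Sp d) :
    HasLineDerivAt ℝ (fun x => F x (a • x)) (F' e (a • x) + a • G e) x e := by
  have h1 : HasDerivAt (fun t : ℝ => F (x + t • e)) (F' e) 0 := hF.hasLineDerivAt e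
  have hz : HasDerivAt (fun t : ℝ => a • (x + t • e)) (a • e) 0 := by
    have : HasDerivAt (fun t : ℝ => t • e) e 0 := by simpa using (hasDerivAt_id (0 : ℝ)).smul_const e
    exact (this.const_add x).const_smul a
  have hz0 : a • (x + (0 : ℝ) • e) = a • x := by simp
  have h2 : HasDerivAt (fun t : ℝ => F x (a • (x + t • e))) (a • G e) 0 := by
    have := HasFDerivAt.comp_hasDerivAt (x := (0 : ℝ)) (f := fun t : ℝ => a • (x + t • e))
      (l := F x) (l' := G) (by rw [hz0]; exact hG) hz
    simpa [Function.comp_def] using this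
  rw [hasDerivAt_iff_tendsto_slope_zero] at h1 h2
  have hzt : Tendsto (fun t : ℝ => a • (x + t • e)) (𝓝[≠] 0) (𝓝 (a • x)) := by
    have := hz.continuousAt.tendsto.mono_left (nhdsWithin_le_nhds (s := {0}ᶜ))
    rwa [hz0] at this
  have h3 := ((continuous_eval (F := Sp d →ᵇ Sp d)).tendsto (F' e, a • x)).comp
    (h1.prodMk_nhds hzt)
  show HasDerivAt _ _ _
  rw [hasDerivAt_iff_tendsto_slope_zero]
  refine (h3.add h2).congr fun t => ?_
  simp only [Function.comp, zero_add, zero_smul, add_zero, BoundedContinuousFunction.coe_smul,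
    BoundedContinuousFunction.coe_sub, Pi.sub_apply]
  rw [← smul_add, sub_add_sub_cancel]

theorem integrable_mul_of_tsupport_subset {d : ℕ} {Ω : Set (Sp d)} {φ p : Sp d → ℝ}
    (hφ : Continuous φ) (hc : HasCompactSupport φ) (hs : tsupport φ ⊆ Ω) (hp : ContinuousOn p Ω) :
    Integrable (fun x => φ x * p x) volume := by
  have h1 : IntegrableOn (fun x => φ x * p x) (tsupport φ) volume :=
    (hφ.continuousOn.mul (hp.mono hs)).integrableOn_compact hc
  refine h1.integrable_of_forall_notMem_eq_zero fun x hx => ?_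
  rw [image_eq_zero_of_notMem_tsupport hx, zero_mul]

theorem IsCoefficient.continuousOn_osc {d : ℕ} {Ω : Set (Sp d)} {a : Sp d → Sp d → ℝ}
    (ha : IsCoefficient Ω a) (ε : ℝ) : ContinuousOn (osc a ε) Ω :=
  ha.continuousOn.comp (f := fun x : Sp d => (x, ε⁻¹ • x))
    (continuous_id.prodMk (continuous_id.const_smul ε⁻¹)).continuousOn fun _ hx => ⟨hx, mem_univ _⟩

theorem IsCoefficient.aestronglyMeasurable_osc {d : ℕ} {Ω : Set (Sp d)} {a : Sp d → Sp d → ℝ}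
    (ha : IsCoefficient Ω a) (hΩ : IsOpen Ω) (ε : ℝ) :
    AEStronglyMeasurable (osc a ε) (spaceMeasure Ω) :=
  (ha.continuousOn_osc ε).aestronglyMeasurable hΩ.measurableSet

theorem IsCoefficient.exists_osc_bound {d : ℕ} {Ω : Set (Sp d)} {a : Sp d → Sp d → ℝ}
    (ha : IsCoefficient Ω a) (hΩ : IsOpen Ω) :
    ∃ M : ℝ, 0 ≤ M ∧ ∀ ε, ∀ᵐ x ∂spaceMeasure Ω, |osc a ε x| ≤ M := by
  obtain ⟨M, hM⟩ := ha.bounded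
  refine ⟨max M 0, le_max_right _ _, fun ε => ?_⟩
  filter_upwards [ae_restrict_mem hΩ.measurableSet] with x hx
  exact (hM x hx _).trans (le_max_left _ _)

theorem continuousOn_eval_smul {d : ℕ} {E : Type*} [PseudoMetricSpace E] {s : Set (Sp d)}
    {F : Sp d → (Sp d →ᵇ E)} (hF : ContinuousOn F s) (a : ℝ) :
    ContinuousOn (fun x => F x (a • x)) s := by
  have h := (continuous_eval (F := Sp d →ᵇ E)).comp_continuousOn
    (hF.prodMk (continuous_id.const_smul a).continuousOn)
  exact h

/-- The divergence in `x`, at the point `(x, y)`, of a vector field whose `x`-derivative is `L`. -/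
def slowDivergence {d : ℕ} (L : Sp d →L[ℝ] (Sp d →ᵇ Sp d)) (y : Sp d) : ℝ :=
  ∑ i : Fin d, (L (EuclideanSpace.single i 1) y) i

/-- The identity `ε⁻¹ (div_y F)(x, x/ε) = div (F(x, x/ε)) - (div_x F)(x, x/ε)`, in the weak
form. -/
theorem integral_osc_mul_testFunction {d : ℕ} {Ω : Set (Sp d)} (hΩ : IsOpen Ω) {Q : Sp d → Sp d → ℝ}
    {F : Sp d → (Sp d →ᵇ Sp d)} {F' : Sp d → (Sp d →L[ℝ] (Sp d →ᵇ Sp d))}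
    {G : Sp d → (Sp d →ᵇ (Sp d →L[ℝ] Sp d))}
    (hF : ContinuousOn F Ω) (hF' : ContinuousOn F' Ω) (hG : ContinuousOn G Ω)
    (hFF' : ∀ x ∈ Ω, HasFDerivAt F (F' x) x) (hFG : ∀ x ∈ Ω, ∀ y, HasFDerivAt (F x) (G x y) y)
    (hQ : ∀ x ∈ Ω, ∀ y, ∑ i : Fin d, (G x y (EuclideanSpace.single i 1)) i = Q x y)
    (ε : ℝ) {θ : Sp d → ℝ} (hθ : IsTestFunction Ω θ) :
    ∫ x in Ω, (ε⁻¹ * osc Q ε x) * θ x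
      = -∫ x in Ω, (inner ℝ (F x (ε⁻¹ • x)) (gradient θ x)
        + slowDivergence (F' x) (ε⁻¹ • x) * θ x) := by
  have hθd : Differentiable ℝ θ := hθ.smooth.differentiable (by simp)
  have hθ' : ∀ e, Continuous fun x => fderiv ℝ θ x e := fun e =>
    (hθ.smooth.continuous_fderiv (by simp)).clm_apply continuous_const
  have hθ'c : ∀ e, HasCompactSupport fun x => fderiv ℝ θ x e := fun e =>
    hθ.compact.fderiv_apply ℝ e
  have hθ's : ∀ e, tsupport (fun x => fderiv ℝ θ x e) ⊆ Ω := fun e =>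
    (tsupport_fderiv_apply_subset ℝ e).trans hθ.support
  have hcoord : ∀ {p : Sp d → Sp d} (i : Fin d), ContinuousOn p Ω →
      ContinuousOn (fun x => p x i) Ω := fun i hp =>
    (EuclideanSpace.proj i : Sp d →L[ℝ] ℝ).continuous.comp_continuousOn hp
  have hFc : ContinuousOn (fun x => F x (ε⁻¹ • x)) Ω := continuousOn_eval_smul hF _
  have hF'c : ∀ e, ContinuousOn (fun x => F' x e (ε⁻¹ • x)) Ω := fun e =>
    continuousOn_eval_smul (hF'.clm_apply continuousOn_const) _
  have hGc : ∀ e, ContinuousOn (fun x => G x (ε⁻¹ • x) e) Ω := fun e =>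
    (continuousOn_eval_smul hG _).clm_apply continuousOn_const
  have hsumc : ∀ e, ContinuousOn
      (fun x => F' x e (ε⁻¹ • x) + ε⁻¹ • G x (ε⁻¹ • x) e) Ω := fun e =>
    (hF'c e).add ((hGc e).const_smul ε⁻¹)
  -- integration by parts in the `i`-th direction
  have hibp : ∀ i : Fin d,
      ∫ x, θ x * (F' x (EuclideanSpace.single i 1) (ε⁻¹ • x)
          + ε⁻¹ • G x (ε⁻¹ • x) (EuclideanSpace.single i 1)) i
        = -∫ x, fderiv ℝ θ x (EuclideanSpace.single i 1) * (F x (ε⁻¹ • x)) i := by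
    intro i
    refine integral_bilinear_hasLineDerivAt_right_eq_neg_left_of_integrable
      (B := ContinuousLinearMap.mul ℝ ℝ) (v := EuclideanSpace.single i 1)
      (g := fun x => (F x (ε⁻¹ • x)) i) ?_ ?_ ?_ ?_ ?_
    · exact integrable_mul_of_tsupport_subset (hθ' _) (hθ'c _) (hθ's _) (hcoord i hFc)
    · exact integrable_mul_of_tsupport_subset hθ.smooth.continuous hθ.compact hθ.support
        (hcoord i (hsumc _))
    · exact integrable_mul_of_tsupport_subset hθ.smooth.continuous hθ.compact hθ.support
        (hcoord i hFc)
    · exact fun x _ => (hθd x).hasFDerivAt.hasLineDerivAt _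
    · intro x hx
      have hxΩ := hθ.support hx
      have h1 := hasLineDerivAt_eval_smul (hFF' x hxΩ) (hFG x hxΩ (ε⁻¹ • x))
        (EuclideanSpace.single i 1)
      exact (EuclideanSpace.proj i : Sp d →L[ℝ] ℝ).hasFDerivAt.comp_hasDerivAt
        (0 : ℝ) h1
  have i1 : ∀ i : Fin d, Integrable (fun x => θ x *
      (F' x (EuclideanSpace.single i 1) (ε⁻¹ • x)
        + ε⁻¹ • G x (ε⁻¹ • x) (EuclideanSpace.single i 1)) i) volume := fun i =>
    integrable_mul_of_tsupport_subset hθ.smooth.continuous hθ.compact hθ.support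
      (hcoord i (hsumc _))
  have i2 : ∀ i : Fin d, Integrable (fun x => fderiv ℝ θ x (EuclideanSpace.single i 1)
      * (F x (ε⁻¹ • x)) i) volume := fun i =>
    integrable_mul_of_tsupport_subset (hθ' _) (hθ'c _) (hθ's _) (hcoord i hFc)
  have hzero : ∀ x ∉ Ω, θ x = 0 ∧ fderiv ℝ θ x = 0 := by
    intro x hx
    have h1 : x ∉ tsupport θ := fun h => hx (hθ.support h)
    exact ⟨image_eq_zero_of_notMem_tsupport h1,
      image_eq_zero_of_notMem_tsupport fun h => h1 (tsupport_fderiv_subset ℝ h)⟩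
  have hgrad : ∀ x, ∑ i : Fin d, fderiv ℝ θ x (EuclideanSpace.single i 1) * (F x (ε⁻¹ • x)) i
      = inner ℝ (F x (ε⁻¹ • x)) (gradient θ x) := by
    intro x
    rw [PiLp.inner_apply]
    refine Finset.sum_congr rfl fun i _ => ?_
    have h1 : inner ℝ (gradient θ x) (EuclideanSpace.single i (1 : ℝ))
        = fderiv ℝ θ x (EuclideanSpace.single i 1) := by
      simp [gradient]
    rw [← h1, EuclideanSpace.inner_single_right]
    simp
  have hsum : ∫ x, ∑ i : Fin d, θ x * (F' x (EuclideanSpace.single i 1) (ε⁻¹ • x)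
        + ε⁻¹ • G x (ε⁻¹ • x) (EuclideanSpace.single i 1)) i
      = -∫ x, inner ℝ (F x (ε⁻¹ • x)) (gradient θ x) := by
    rw [integral_finsetSum _ fun i _ => i1 i]
    simp only [hibp, ← hgrad]
    rw [integral_finsetSum _ fun i _ => i2 i, Finset.sum_neg_distrib]
  have hleft : ∫ x, ∑ i : Fin d, θ x * (F' x (EuclideanSpace.single i 1) (ε⁻¹ • x)
        + ε⁻¹ • G x (ε⁻¹ • x) (EuclideanSpace.single i 1)) i
      = ∫ x in Ω, ((ε⁻¹ * osc Q ε x) * θ x + slowDivergence (F' x) (ε⁻¹ • x) * θ x) := by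
    rw [← setIntegral_eq_integral_of_forall_compl_eq_zero (s := Ω) fun x hx =>
      Finset.sum_eq_zero fun i _ => by rw [(hzero x hx).1, zero_mul]]
    refine setIntegral_congr_fun hΩ.measurableSet fun x hx => ?_
    simp only [osc, ← hQ x hx, slowDivergence, Finset.mul_sum, Finset.sum_mul,
      ← Finset.sum_add_distrib]
    refine Finset.sum_congr rfl fun i _ => ?_
    simp only [PiLp.add_apply, PiLp.smul_apply, smul_eq_mul]
    ring
  have hright : ∫ x in Ω, inner ℝ (F x (ε⁻¹ • x)) (gradient θ x)
      = ∫ x, inner ℝ (F x (ε⁻¹ • x)) (gradient θ x) :=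
    setIntegral_eq_integral_of_forall_compl_eq_zero fun x hx => by
      simp [gradient, (hzero x hx).2]
  have hdc : ContinuousOn (fun x => slowDivergence (F' x) (ε⁻¹ • x)) Ω :=
    continuousOn_finsetSum _ fun i _ => hcoord i (hF'c _)
  have hdint : IntegrableOn (fun x => slowDivergence (F' x) (ε⁻¹ • x) * θ x) Ω volume := by
    simpa only [mul_comm] using (integrable_mul_of_tsupport_subset hθ.smooth.continuous hθ.compact
      hθ.support hdc).integrableOn
  have hgint : IntegrableOn (fun x => inner ℝ (F x (ε⁻¹ • x)) (gradient θ x)) Ω volume := by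
    simp only [← hgrad]
    exact (integrable_finsetSum _ fun i _ => i2 i).integrableOn
  have hQint : IntegrableOn (fun x => (ε⁻¹ * osc Q ε x) * θ x) Ω volume := by
    have hQc : ContinuousOn (fun x => ε⁻¹ * osc Q ε x) Ω := by
      have : ContinuousOn (fun x => ε⁻¹ * ∑ i : Fin d,
          (G x (ε⁻¹ • x) (EuclideanSpace.single i 1)) i) Ω :=
        continuousOn_const.mul (continuousOn_finsetSum _ fun i _ => hcoord i (hGc _))
      exact this.congr fun x hx => by simp only [osc, ← hQ x hx]
    simpa only [mul_comm] using (integrable_mul_of_tsupport_subset hθ.smooth.continuous hθ.compact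
      hθ.support hQc).integrableOn
  rw [hleft, integral_add hQint hdint, ← hright] at hsum
  rw [integral_add hgint hdint]
  linarith

theorem abs_slowDivergence_le {d : ℕ} (L : Sp d →L[ℝ] (Sp d →ᵇ Sp d)) (y : Sp d) :
    |slowDivergence L y| ≤ d * ‖L‖ := by
  have h : ∀ i ∈ (Finset.univ : Finset (Fin d)),
      |(L (EuclideanSpace.single i 1) y) i| ≤ ‖L‖ := by
    intro i _
    calc |(L (EuclideanSpace.single i 1) y) i| ≤ ‖L (EuclideanSpace.single i 1) y‖ :=
          PiLp.norm_apply_le (L (EuclideanSpace.single i 1) y) i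
      _ ≤ ‖L (EuclideanSpace.single i 1)‖ := BoundedContinuousFunction.norm_coe_le_norm _ _
      _ ≤ ‖L‖ * ‖(EuclideanSpace.single i 1 : Sp d)‖ := L.le_opNorm _
      _ = ‖L‖ := by simp
  refine (Finset.abs_sum_le_sum_abs _ _).trans ((Finset.sum_le_sum h).trans ?_)
  simp

/-- The reaction form `∫ ε⁻¹ Q^ε v²` is bounded on `H¹₀(Ω)` uniformly in `ε`, though its
coefficient is of order `ε⁻¹`. -/
theorem exists_reaction_bound {d : ℕ} {Ω : Set (Sp d)} (hΩ : IsOpen Ω)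
    (hΩb : Bornology.IsBounded Ω) {Q : Sp d → Sp d → ℝ} (hQ : IsCoefficient Ω Q)
    {R : Sp d → Sp d → Sp d} (hR : IsC1C1 Ω R) (hRQ : ∀ x ∈ Ω, ∀ y, divergence (R x) y = Q x y) :
    ∃ C : ℝ, 0 ≤ C ∧ ∀ ε, ∀ v : V Ω,
      |∫ x in Ω, (ε⁻¹ * osc Q ε x) * inner ℝ (V.fn v x) (V.fn v x)|
        ≤ C * (‖V.fn v‖ ^ 2 + ‖V.fn v‖ * ‖V.grad v‖) := by
  obtain ⟨F, G, hFG, ⟨hFc, F', hF'c, hFF'⟩, hGc, -⟩ := hR.regular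
  have hK : IsCompact (closure Ω) := hΩb.isCompact_closure
  have hsub : Ω ⊆ closure Ω := subset_closure
  obtain ⟨M, hM⟩ := hK.exists_bound_of_continuousOn hFc
  obtain ⟨M', hM'⟩ := hK.exists_bound_of_continuousOn hF'c
  have hFR : ∀ x ∈ Ω, (F x : Sp d → Sp d) = R x := fun x hx =>
    funext fun y => (hFG x (hsub hx) y).1
  have hFG' : ∀ x ∈ Ω, ∀ y, HasFDerivAt (F x) (G x y) y := fun x hx y => by
    rw [hFR x hx]
    exact (hFG x (hsub hx) y).2
  have hQG : ∀ x ∈ Ω, ∀ y, ∑ i : Fin d, (G x y (EuclideanSpace.single i 1)) i = Q x y :=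
    fun x hx y => by rw [← hRQ x hx y, divergence, (hFG x (hsub hx) y).2.fderiv]
  obtain ⟨MQ, hMQ0, hMQ⟩ := hQ.exists_osc_bound hΩ
  set C : ℝ := max (2 * M) (max (d * M') 0) with hC
  have hC0 : 0 ≤ C := (le_max_right _ _).trans (le_max_right _ _)
  have hCM : 2 * M ≤ C := le_max_left _ _
  have hCM' : d * M' ≤ C := (le_max_left _ _).trans (le_max_right _ _)
  refine ⟨C, hC0, fun ε => ?_⟩
  obtain ⟨b, hb, -⟩ := exists_weighted_form (F := ℝ) (μ := spaceMeasure Ω)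
    (c := fun x => ε⁻¹ * osc Q ε x) (M := |ε⁻¹| * MQ)
    ((hQ.aestronglyMeasurable_osc hΩ ε).const_mul _) (by positivity)
    ((hMQ ε).mono fun x hx => by
      rw [abs_mul]
      exact mul_le_mul_of_nonneg_left hx (abs_nonneg _))
  have hcont1 : Continuous fun w : WithLp 2 (H Ω × HVec Ω) => w.fst :=
    (WithLp.fstL 2 ℝ (H Ω) (HVec Ω)).continuous
  have hcont2 : Continuous fun w : WithLp 2 (H Ω × HVec Ω) => w.snd :=
    (WithLp.sndL 2 ℝ (H Ω) (HVec Ω)).continuous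
  refine V.induction_testFunction
    (p := fun f F => |∫ x in Ω, (ε⁻¹ * osc Q ε x) * inner ℝ (f x) (f x)|
        ≤ C * (‖f‖ ^ 2 + ‖f‖ * ‖F‖)) ?_ ?_
  · simp only [← hb]
    refine isClosed_le ?_ (by fun_prop)
    exact ((b.continuous.comp hcont1).clm_apply hcont1).abs
  · intro φ f Φ hφ hf hΦ
    have hφd : Differentiable ℝ φ := hφ.smooth.differentiable (by simp)
    have hθ : IsTestFunction Ω fun x => φ x * φ x :=
      ⟨hφ.smooth.mul hφ.smooth, hφ.compact.mul_left,
        (closure_mono (Function.support_mul_subset_right _ _)).trans hφ.support⟩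
    have e1 : ∫ x in Ω, (ε⁻¹ * osc Q ε x) * inner ℝ (f x) (f x)
        = ∫ x in Ω, (ε⁻¹ * osc Q ε x) * (φ x * φ x) := by
      refine integral_congr_ae ?_
      filter_upwards [hf] with x hx
      rw [hx, real_inner_self_eq_norm_sq, Real.norm_eq_abs, sq_abs, sq]
    rw [e1, integral_osc_mul_testFunction hΩ (hFc.mono hsub) (hF'c.mono hsub) (hGc.mono hsub) hFF'
      hFG' hQG ε hθ, abs_neg]
    have hg : ∀ x, gradient (fun x => φ x * φ x) x = (2 * φ x) • gradient φ x := by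
      intro x
      have := fderiv_fun_mul (hφd x) (hφd x)
      simp only [gradient, this, map_add, map_smul]
      rw [← add_smul, two_mul]
    have hpt : ∀ᵐ x ∂spaceMeasure Ω,
        ‖inner ℝ (F x (ε⁻¹ • x)) (gradient (fun x => φ x * φ x) x)
          + slowDivergence (F' x) (ε⁻¹ • x) * (φ x * φ x)‖
          ≤ C * (‖f x‖ * ‖f x‖ + ‖f x‖ * ‖Φ x‖) := by
      filter_upwards [hf, hΦ, ae_restrict_mem hΩ.measurableSet] with x h1 h2 hx
      have h3 : ‖inner ℝ (F x (ε⁻¹ • x)) (gradient (fun x => φ x * φ x) x)‖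
          ≤ C * (‖f x‖ * ‖Φ x‖) := by
        rw [hg, ← h1, ← h2]
        refine (norm_inner_le_norm _ _).trans ?_
        rw [norm_smul, norm_mul, Real.norm_ofNat]
        have h4 : ‖F x (ε⁻¹ • x)‖ ≤ M :=
          ((F x).norm_coe_le_norm _).trans (hM x (hsub hx))
        calc ‖F x (ε⁻¹ • x)‖ * (2 * ‖f x‖ * ‖Φ x‖) ≤ M * (2 * ‖f x‖ * ‖Φ x‖) := by gcongr
          _ = 2 * M * (‖f x‖ * ‖Φ x‖) := by ring
          _ ≤ C * (‖f x‖ * ‖Φ x‖) := by gcongr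
      have h5 : ‖slowDivergence (F' x) (ε⁻¹ • x) * (φ x * φ x)‖ ≤ C * (‖f x‖ * ‖f x‖) := by
        rw [← h1, norm_mul, norm_mul]
        refine mul_le_mul_of_nonneg_right ?_ (by positivity)
        exact (abs_slowDivergence_le _ _).trans ((mul_le_mul_of_nonneg_left (hM' x (hsub hx))
          (Nat.cast_nonneg d)).trans hCM')
      refine (norm_add_le _ _).trans ?_
      linarith
    have hfi : MemLp (fun x => ‖f x‖) 2 (spaceMeasure Ω) := (Lp.memLp f).norm
    have hΦi : MemLp (fun x => ‖Φ x‖) 2 (spaceMeasure Ω) := (Lp.memLp Φ).norm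
    have iff : Integrable (fun x => ‖f x‖ * ‖f x‖) (spaceMeasure Ω) := hfi.integrable_mul hfi
    have ifΦ : Integrable (fun x => ‖f x‖ * ‖Φ x‖) (spaceMeasure Ω) := hfi.integrable_mul hΦi
    rw [← Real.norm_eq_abs]
    refine (norm_integral_le_of_norm_le ((iff.add ifΦ).const_mul C) hpt).trans ?_
    rw [integral_const_mul]
    refine mul_le_mul_of_nonneg_left ?_ hC0
    show ∫ x, (‖f x‖ * ‖f x‖ + ‖f x‖ * ‖Φ x‖) ∂spaceMeasure Ω ≤ _
    rw [integral_add iff ifΦ, sq]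
    exact add_le_add (integral_norm_mul_norm_le f f) (integral_norm_mul_norm_le f Φ)

/-! ### The energy estimate -/

theorem memLp_affine_combination {α E Y D : Type*} [MeasurableSpace α] {μ : Measure α}
    [NormedAddCommGroup E] [NormedSpace ℝ E] [NormedAddCommGroup Y] [NormedSpace ℝ Y]
    [NormedAddCommGroup D] [NormedSpace ℝ D] (K S : E →L[ℝ] D) (P : Y →L[ℝ] D)
    {u w : α → E} {Z : α → Y} (hu : MemLp u 2 μ) (hw : MemLp w 2 μ) (hZ : MemLp Z 2 μ) :
    MemLp (fun t => -K (u t) + S (w t - u t) + P (Z t)) 2 μ :=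
  ((K.comp_memLp' hu).neg.add (S.comp_memLp' (hw.sub hu))).add (P.comp_memLp' hZ)

/-- The energy inequality for the weak form of `(b u)' + K u = S (w - u) + P Z`, `u(0) = g`. -/
theorem weak_energy_inequality_of_forms {E X Y : Type*} [NormedAddCommGroup E] [NormedSpace ℝ E]
    [NormedAddCommGroup X] [NormedSpace ℝ X] [NormedAddCommGroup Y] [NormedSpace ℝ Y]
    (J : E →L[ℝ] X) (b : X →L[ℝ] X →L[ℝ] ℝ) (hsymm : ∀ x y, b x y = b y x)
    (hpos : ∀ x, 0 ≤ b x x) {T : ℝ} (hT : 0 < T) (K S : E →L[ℝ] E →L[ℝ] ℝ)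
    (P : Y →L[ℝ] E →L[ℝ] ℝ) {u w : ℝ → E} {Z : ℝ → Y} (hu : MemLp u 2 (timeMeasure T))
    (hw : MemLp w 2 (timeMeasure T)) (hZ : MemLp Z 2 (timeMeasure T)) (g : X)
    (hweak : ∀ (v : E) (ψ : ℝ → ℝ), ContDiff ℝ 1 ψ → ψ T = 0 →
      -(∫ t in Ioo 0 T, deriv ψ t * b (J (u t)) (J v)) + (∫ t in Ioo 0 T, ψ t * K (u t) v)
        = (∫ t in Ioo 0 T, ψ t * S (w t - u t) v) + (∫ t in Ioo 0 T, ψ t * P (Z t) v)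
          + ψ 0 * b g (J v)) :
    Integrable (fun s => -K (u s) (u s) + S (w s - u s) (u s) + P (Z s) (u s)) (timeMeasure T) ∧
    ∀ᵐ t ∂timeMeasure T, b (J (u t)) (J (u t)) ≤ b g g + 2 * ∫ s in Ioo 0 t,
      (-K (u s) (u s) + S (w s - u s) (u s) + P (Z s) (u s)) := by
  have l2 := memLp_affine_combination K S P hu hw hZ
  have hlu : Integrable (fun t => (-K (u t) + S (w t - u t) + P (Z t)) (u t)) (timeMeasure T) :=
    memLp_one_iff_integrable.1
      ((ContinuousLinearMap.id ℝ (E →L[ℝ] ℝ)).memLp_of_bilin 1 l2 hu)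
  refine ⟨hlu, weak_energy_inequality J b hsymm hpos hT hu l2 g fun v ψ hψ hψT => ?_⟩
  have hint : ∀ {f : ℝ → ℝ}, MemLp f 2 (timeMeasure T) →
      Integrable (fun t => ψ t * f t) (timeMeasure T) := fun hf =>
    integrable_continuous_smul hψ.continuous (hf.integrable (by norm_num))
  have i1 := hint ((K.flip v).comp_memLp' hu)
  have i2 := hint ((S.flip v).comp_memLp' (hw.sub hu))
  have i3 := hint ((P.flip v).comp_memLp' hZ)
  have e : ∫ t in Ioo 0 T, ψ t * (-K (u t) + S (w t - u t) + P (Z t)) v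
      = -(∫ t in Ioo 0 T, ψ t * K (u t) v)
        + (∫ t in Ioo 0 T, ψ t * S (w t - u t) v) + ∫ t in Ioo 0 T, ψ t * P (Z t) v := by
    have e1 := integral_add i1.neg i2
    have e2 := integral_add (i1.neg.add i2) i3
    simp only [Pi.add_apply, Pi.neg_apply, Function.comp_apply, ContinuousLinearMap.flip_apply,
      integral_neg, Pi.sub_apply] at e1 e2
    rw [← e1, ← e2]
    refine integral_congr_ae (ae_of_all _ fun t => ?_)
    simp only [add_apply, neg_apply]
    ring
  rw [e]
  linarith [hweak v ψ hψ hψT]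

/-- The energy inequality for one equation of the system; `Z` is the source `q`, as a function of
time with values in `L²(Ω)`. -/
theorem WeakEquation.energy_inequality {d : ℕ} {T : ℝ} (hT : 0 < T) {Ω : Set (Sp d)}
    {c k r : Sp d → ℝ} {Mc Mk Mr : ℝ}
    (hc : AEStronglyMeasurable c (spaceMeasure Ω)) (hMc0 : 0 ≤ Mc)
    (hMc : ∀ᵐ x ∂spaceMeasure Ω, |c x| ≤ Mc) (hcpos : ∀ᵐ x ∂spaceMeasure Ω, 0 ≤ c x)
    (hk : AEStronglyMeasurable k (spaceMeasure Ω)) (hMk0 : 0 ≤ Mk)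
    (hMk : ∀ᵐ x ∂spaceMeasure Ω, |k x| ≤ Mk)
    (hr : AEStronglyMeasurable r (spaceMeasure Ω)) (hMr0 : 0 ≤ Mr)
    (hMr : ∀ᵐ x ∂spaceMeasure Ω, |r x| ≤ Mr)
    {q : ℝ × Sp d → ℝ} {Z : ℝ → H Ω} (hZ : MemLp Z 2 (timeMeasure T))
    (hZq : ∀ᵐ t ∂timeMeasure T, Z t =ᵐ[spaceMeasure Ω] fun x => q (t, x))
    {g : H Ω} {u w : L2V T Ω} (h : WeakEquation T Ω c k r q g u w) :
    Integrable (fun s => -(∫ x in Ω, k x * inner ℝ (V.grad (u s) x) (V.grad (u s) x))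
        + (∫ x in Ω, r x * inner ℝ ((V.fn (w s) - V.fn (u s)) x) (V.fn (u s) x))
        + inner ℝ (Z s) (V.fn (u s))) (timeMeasure T) ∧
    ∀ᵐ t ∂timeMeasure T, (∫ x in Ω, c x * inner ℝ (V.fn (u t) x) (V.fn (u t) x))
      ≤ (∫ x in Ω, c x * inner ℝ (g x) (g x))
        + 2 * ∫ s in Ioo 0 t,
          (-(∫ x in Ω, k x * inner ℝ (V.grad (u s) x) (V.grad (u s) x))
            + (∫ x in Ω, r x * inner ℝ ((V.fn (w s) - V.fn (u s)) x) (V.fn (u s) x))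
            + inner ℝ (Z s) (V.fn (u s))) := by
  obtain ⟨b, hb, -⟩ := exists_weighted_form (F := ℝ) hc hMc0 hMc
  obtain ⟨bk, hbk, -⟩ := exists_weighted_form (F := Sp d) hk hMk0 hMk
  obtain ⟨br, hbr, -⟩ := exists_weighted_form (F := ℝ) hr hMr0 hMr
  obtain ⟨b1, hb1, -⟩ := exists_weighted_form (F := ℝ) (μ := spaceMeasure Ω) (c := fun _ => 1)
    aestronglyMeasurable_const zero_le_one (ae_of_all _ fun _ => by simp)
  have hb1' : ∀ f f' : H Ω, b1 f f' = inner ℝ f f' := fun f f' => by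
    rw [hb1, L2.inner_def]
    simp
  obtain ⟨K, hK⟩ : ∃ K : V Ω →L[ℝ] V Ω →L[ℝ] ℝ, ∀ v v', K v v' = bk (V.grad v) (V.grad v') :=
    ⟨bk.bilinearComp (V.gradL Ω) (V.gradL Ω), fun _ _ => rfl⟩
  obtain ⟨S, hS⟩ : ∃ S : V Ω →L[ℝ] V Ω →L[ℝ] ℝ, ∀ v v', S v v' = br (V.fn v) (V.fn v') :=
    ⟨br.bilinearComp (V.fnL Ω) (V.fnL Ω), fun _ _ => rfl⟩
  obtain ⟨P, hP⟩ : ∃ P : H Ω →L[ℝ] V Ω →L[ℝ] ℝ, ∀ f v', P f v' = b1 f (V.fn v') :=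
    ⟨b1.bilinearComp (ContinuousLinearMap.id ℝ _) (V.fnL Ω), fun _ _ => rfl⟩
  have hu : MemLp u 2 (timeMeasure T) := Lp.memLp u
  have hw : MemLp w 2 (timeMeasure T) := Lp.memLp w
  have hfnsub : ∀ v v' : V Ω, V.fn (v - v') = V.fn v - V.fn v' := fun v v' =>
    map_sub (V.fnL Ω) v v'
  have hsymm : ∀ f f', b f f' = b f' f := fun f f' => by simp only [hb, real_inner_comm]
  have hpos : ∀ f, 0 ≤ b f f := by
    intro f
    rw [hb]
    refine integral_nonneg_of_ae ?_
    filter_upwards [hcpos] with x hx using mul_nonneg hx real_inner_self_nonneg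
  have key := weak_energy_inequality_of_forms (V.fnL Ω) b hsymm hpos hT K S P hu hw hZ g ?_
  · simpa only [hK, hS, hP, hfnsub, hb1', V.fnL_apply, hb, hbk, hbr] using key
  · intro v ψ hψ hψT
    have hv := h v ψ hψ hψT
    have e1 : ∀ f : H Ω, ∫ x in Ω, c x * f x * V.fn v x = b f (V.fnL Ω v) := by
      intro f
      rw [hb]
      refine integral_congr_ae (ae_of_all _ fun x => ?_)
      simp only [V.fnL_apply, RCLike.inner_apply, conj_trivial]
      ring
    have e2 : ∀ t, ∫ x in Ω, k x * inner ℝ (V.grad (u t) x) (V.grad v x) = K (u t) v := by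
      intro t
      rw [hK, hbk]
    have e3 : ∀ t, ∫ x in Ω, r x * (V.fn (w t) x - V.fn (u t) x) * V.fn v x
        = S (w t - u t) v := by
      intro t
      rw [hS, hbr, hfnsub]
      refine integral_congr_ae ?_
      filter_upwards [Lp.coeFn_sub (V.fn (w t)) (V.fn (u t))] with x hx
      rw [hx]
      simp only [Pi.sub_apply, RCLike.inner_apply, conj_trivial]
      ring
    have e4 : ∫ t in Ioo 0 T, ψ t * ∫ x in Ω, q (t, x) * V.fn v x
        = ∫ t in Ioo 0 T, ψ t * P (Z t) v := by
      refine integral_congr_ae ?_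
      filter_upwards [hZq] with t ht
      rw [hP, hb1', L2.inner_def]
      congr 1
      refine integral_congr_ae ?_
      filter_upwards [ht] with x hx
      rw [hx]
      simp only [RCLike.inner_apply, conj_trivial]
      ring
    simpa only [e1, e2, e3, e4, V.fnL_apply] using hv

/-- The exchange terms of the two equations add up to the reaction form at `v₂ - v₁`, whose
gradient part is absorbed by the diffusion. -/
theorem dissipation_le {d : ℕ} {Ω : Set (Sp d)} {k₁ k₂ r : Sp d → ℝ} {M₁ M₂ Mr κ C : ℝ}
    (hk₁ : AEStronglyMeasurable k₁ (spaceMeasure Ω)) (hM₁ : ∀ᵐ x ∂spaceMeasure Ω, |k₁ x| ≤ M₁)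
    (hk₂ : AEStronglyMeasurable k₂ (spaceMeasure Ω)) (hM₂ : ∀ᵐ x ∂spaceMeasure Ω, |k₂ x| ≤ M₂)
    (hr : AEStronglyMeasurable r (spaceMeasure Ω)) (hMr0 : 0 ≤ Mr)
    (hMr : ∀ᵐ x ∂spaceMeasure Ω, |r x| ≤ Mr) (hκ : 0 < κ)
    (hκ₁ : ∀ᵐ x ∂spaceMeasure Ω, κ ≤ k₁ x) (hκ₂ : ∀ᵐ x ∂spaceMeasure Ω, κ ≤ k₂ x) (hC : 0 ≤ C)
    (hrC : ∀ v : V Ω, |∫ x in Ω, r x * inner ℝ (V.fn v x) (V.fn v x)|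
      ≤ C * (‖V.fn v‖ ^ 2 + ‖V.fn v‖ * ‖V.grad v‖)) (v₁ v₂ : V Ω) (z : H Ω) :
    (-(∫ x in Ω, k₁ x * inner ℝ (V.grad v₁ x) (V.grad v₁ x))
        + (∫ x in Ω, r x * inner ℝ ((V.fn v₂ - V.fn v₁) x) (V.fn v₁ x)) + inner ℝ z (V.fn v₁))
      + (-(∫ x in Ω, k₂ x * inner ℝ (V.grad v₂ x) (V.grad v₂ x))
        + (∫ x in Ω, r x * inner ℝ ((V.fn v₁ - V.fn v₂) x) (V.fn v₂ x)) + inner ℝ z (V.fn v₂))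
      ≤ -(κ / 2) * (‖V.grad v₁‖ ^ 2 + ‖V.grad v₂‖ ^ 2)
        + (2 * C + 2 * C ^ 2 / κ + 1 / 2) * (‖V.fn v₁‖ ^ 2 + ‖V.fn v₂‖ ^ 2) + ‖z‖ ^ 2 := by
  obtain ⟨b, hb, -⟩ := exists_weighted_form (F := ℝ) hr hMr0 hMr
  have hfn : V.fn (v₂ - v₁) = V.fn v₂ - V.fn v₁ := map_sub (V.fnL Ω) v₂ v₁
  have hgr : V.grad (v₂ - v₁) = V.grad v₂ - V.grad v₁ := map_sub (V.gradL Ω) v₂ v₁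
  have h1 := mul_norm_sq_le_integral_weight hk₁ hM₁ hκ₁ (V.grad v₁)
  have h2 := mul_norm_sq_le_integral_weight hk₂ hM₂ hκ₂ (V.grad v₂)
  have h3 := hrC (v₂ - v₁)
  rw [hfn, hgr, ← hb] at h3
  rw [← hb, ← hb]
  have h4 : b (V.fn v₂ - V.fn v₁) (V.fn v₁) + b (V.fn v₁ - V.fn v₂) (V.fn v₂)
      = -b (V.fn v₂ - V.fn v₁) (V.fn v₂ - V.fn v₁) := by
    simp only [map_sub, sub_apply]
    ring
  have h5 := real_inner_le_norm z (V.fn v₁)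
  have h6 := real_inner_le_norm z (V.fn v₂)
  have h7 := neg_abs_le (b (V.fn v₂ - V.fn v₁) (V.fn v₂ - V.fn v₁))
  have par : ∀ {F : Type} [NormedAddCommGroup F] [InnerProductSpace ℝ F] (x y : F),
      ‖x - y‖ ^ 2 ≤ 2 * (‖y‖ ^ 2 + ‖x‖ ^ 2) := by
    intro F _ _ x y
    have := parallelogram_law_with_norm ℝ x y
    nlinarith [sq_nonneg ‖x + y‖]
  have h8 := par (V.fn v₂) (V.fn v₁)
  have h9 := par (V.grad v₂) (V.grad v₁)
  set A := ‖V.fn v₂ - V.fn v₁‖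
  set B := ‖V.grad v₂ - V.grad v₁‖
  -- Young's inequality
  have h10 : C * (A * B) ≤ κ / 4 * B ^ 2 + C ^ 2 / κ * A ^ 2 := by
    have : κ / 4 * B ^ 2 + C ^ 2 / κ * A ^ 2 - C * (A * B) = (κ / 2 * B - C * A) ^ 2 / κ := by
      field_simp
      ring
    have : 0 ≤ (κ / 2 * B - C * A) ^ 2 / κ := by positivity
    linarith
  have h11 : ‖z‖ * ‖V.fn v₁‖ ≤ ‖z‖ ^ 2 / 2 + ‖V.fn v₁‖ ^ 2 / 2 := by
    nlinarith [sq_nonneg (‖z‖ - ‖V.fn v₁‖)]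
  have h12 : ‖z‖ * ‖V.fn v₂‖ ≤ ‖z‖ ^ 2 / 2 + ‖V.fn v₂‖ ^ 2 / 2 := by
    nlinarith [sq_nonneg (‖z‖ - ‖V.fn v₂‖)]
  have h13 : κ / 4 * B ^ 2 ≤ κ / 4 * (2 * (‖V.grad v₁‖ ^ 2 + ‖V.grad v₂‖ ^ 2)) := by gcongr
  have h14 : (C + C ^ 2 / κ) * A ^ 2
      ≤ (C + C ^ 2 / κ) * (2 * (‖V.fn v₁‖ ^ 2 + ‖V.fn v₂‖ ^ 2)) := by gcongr
  have h15 : C ^ 2 / κ * A ^ 2 + C * A ^ 2 = (C + C ^ 2 / κ) * A ^ 2 := by ring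
  have h16 : (2 * C + 2 * C ^ 2 / κ + 1 / 2) * (‖V.fn v₁‖ ^ 2 + ‖V.fn v₂‖ ^ 2)
      = (C + C ^ 2 / κ) * (2 * (‖V.fn v₁‖ ^ 2 + ‖V.fn v₂‖ ^ 2))
        + (‖V.fn v₁‖ ^ 2 / 2 + ‖V.fn v₂‖ ^ 2 / 2) := by ring
  rw [h16]
  linarith

/-- An energy inequality with growth bounds the solution and its dissipation: Grönwall's
inequality for `N`, then continuity of `t ↦ ∫₀ᵗ D` up to `t = T`. -/
theorem bounds_of_energy_inequality {T a κ A B : ℝ} (hT : 0 < T) (ha : 0 < a) (hκ : 0 < κ)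
    (hA : 0 ≤ A) (hB : 0 ≤ B) {N D : ℝ → ℝ} (hN : Integrable N (timeMeasure T))
    (hD : Integrable D (timeMeasure T)) (hN0 : ∀ t, 0 ≤ N t) (hD0 : ∀ t, 0 ≤ D t)
    (h : ∀ᵐ t ∂timeMeasure T,
      a * N t + κ * (∫ s in Ioo 0 t, D s) ≤ A + B * ∫ s in Ioo 0 t, N s) :
    (∀ᵐ t ∂timeMeasure T, N t ≤ gronwallConst T (A / a) (B / a)) ∧
      (∫ t in Ioo 0 T, N t) ≤ T * gronwallConst T (A / a) (B / a) ∧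
      (∫ t in Ioo 0 T, D t) ≤ (A + B * (T * gronwallConst T (A / a) (B / a))) / κ := by
  set K := gronwallConst T (A / a) (B / a)
  have hNK : ∀ᵐ t ∂timeMeasure T, N t ≤ K := by
    refine ae_le_gronwallConst hT (by positivity) (by positivity) hN hN0 ?_
    filter_upwards [h] with t ht
    have h1 : 0 ≤ κ * ∫ s in Ioo 0 t, D s := mul_nonneg hκ.le (integral_nonneg hD0)
    rw [div_mul_eq_mul_div, ← add_div, le_div_iff₀ ha]
    linarith
  have hNint : (∫ t in Ioo 0 T, N t) ≤ T * K := by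
    refine (integral_mono_ae hN (integrable_const K) hNK).trans ?_
    simp [hT.le]
  refine ⟨hNK, hNint, ?_⟩
  set I : ℝ → ℝ := fun t => ∫ s in (0 : ℝ)..t, (Ioo 0 T).indicator D s with hI
  have hD' : Integrable ((Ioo 0 T).indicator D) volume :=
    (integrable_indicator_iff measurableSet_Ioo).2 hD
  have hIcont : Continuous I := intervalIntegral.continuous_primitive
    (fun _ _ => hD'.intervalIntegrable) 0
  have hIeq : ∀ t ∈ Icc 0 T, I t = ∫ s in Ioo 0 t, D s := by
    intro t ht
    simp only [hI]
    rw [intervalIntegral.integral_of_le ht.1, integral_Ioc_eq_integral_Ioo]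
    exact setIntegral_congr_fun measurableSet_Ioo fun s hs =>
      indicator_of_mem (show s ∈ Ioo 0 T from ⟨hs.1, hs.2.trans_le ht.2⟩) _
  have hIae : ∀ᵐ t ∂timeMeasure T, I t ≤ (A + B * (T * K)) / κ := by
    filter_upwards [h, ae_restrict_mem measurableSet_Ioo] with t ht htT
    rw [hIeq t (Ioo_subset_Icc_self htT), le_div_iff₀ hκ]
    have h1 : (∫ s in Ioo 0 t, N s) ≤ ∫ s in Ioo 0 T, N s :=
      setIntegral_mono_set hN (ae_of_all _ hN0) (Ioo_subset_Ioo_right htT.2.le).eventuallyLE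
    have h2 : 0 ≤ a * N t := mul_nonneg ha.le (hN0 t)
    have h3 := mul_le_mul_of_nonneg_left (h1.trans hNint) hB
    linarith
  have hmax : (fun t => max (I t) ((A + B * (T * K)) / κ))
      =ᵐ[volume.restrict (Icc 0 T)] fun _ => (A + B * (T * K)) / κ := by
    rw [restrict_Ioo_eq_restrict_Icc.symm]
    filter_upwards [hIae] with t ht using max_eq_right ht
  have := Measure.eqOn_Icc_of_ae_eq volume hT.ne hmax
    (hIcont.max continuous_const).continuousOn continuousOn_const (right_mem_Icc.2 hT.le)
  rw [← hIeq T (right_mem_Icc.2 hT.le)]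
  exact max_eq_right_iff.1 this

theorem norm_sq_eq_integral_norm_sq {α E : Type*} [MeasurableSpace α] {μ : Measure α}
    [NormedAddCommGroup E] [InnerProductSpace ℝ E] (f : Lp E 2 μ) :
    ‖f‖ ^ 2 = ∫ t, ‖f t‖ ^ 2 ∂μ := by
  rw [← real_inner_self_eq_norm_sq, L2.inner_def]
  simp only [real_inner_self_eq_norm_sq]

/-- Passage from bounds for squares to bounds for the `L^∞(0, T; H)` and `L²(0, T; V)` norms. -/
theorem eLpNorm_le_of_sq_le {d : ℕ} {T : ℝ} {Ω : Set (Sp d)} (u : L2V T Ω) {K₁ K₂ : ℝ} {K : ℝ≥0}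
    (h₁ : ∀ᵐ t ∂timeMeasure T, ‖V.fn (u t)‖ ^ 2 ≤ K₁) (h₂ : ∫ t in Ioo 0 T, ‖u t‖ ^ 2 ≤ K₂)
    (hK₁ : √K₁ ≤ K) (hK₂ : √K₂ ≤ K) :
    eLpNorm (fun t => V.fn (u t)) ⊤ (timeMeasure T) ≤ (K : ℝ≥0∞) ∧
      eLpNorm u 2 (timeMeasure T) ≤ (K : ℝ≥0∞) := by
  constructor
  · rw [eLpNorm_exponent_top, ← ENNReal.ofReal_coe_nnreal]
    refine eLpNormEssSup_le_of_ae_bound ?_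
    filter_upwards [h₁] with t ht
    exact (Real.le_sqrt_of_sq_le ht).trans hK₁
  · rw [← norm_sq_eq_integral_norm_sq] at h₂
    rw [← ENNReal.ofReal_toReal (Lp.eLpNorm_ne_top u), ← Lp.norm_def,
      ← ENNReal.ofReal_coe_nnreal]
    exact ENNReal.ofReal_le_ofReal ((Real.le_sqrt_of_sq_le h₂).trans hK₂)

theorem integrable_norm_fn_sq {d : ℕ} {T : ℝ} {Ω : Set (Sp d)} (u : L2V T Ω) :
    Integrable (fun t => ‖V.fn (u t)‖ ^ 2) (timeMeasure T) :=
  ((V.fnL Ω).comp_memLp' (Lp.memLp u)).integrable_norm_pow (by norm_num)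

theorem integrable_norm_grad_sq {d : ℕ} {T : ℝ} {Ω : Set (Sp d)} (u : L2V T Ω) :
    Integrable (fun t => ‖V.grad (u t)‖ ^ 2) (timeMeasure T) :=
  ((V.gradL Ω).comp_memLp' (Lp.memLp u)).integrable_norm_pow (by norm_num)

theorem integral_weight_le {α F : Type*} [MeasurableSpace α] [NormedAddCommGroup F]
    [InnerProductSpace ℝ F] {μ : Measure α} {c : α → ℝ} {M : ℝ} (hc : AEStronglyMeasurable c μ)
    (hM0 : 0 ≤ M) (hM : ∀ᵐ x ∂μ, |c x| ≤ M) (f : Lp F 2 μ) :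
    ∫ x, c x * inner ℝ (f x) (f x) ∂μ ≤ M * ‖f‖ ^ 2 := by
  obtain ⟨b, hb, hbM⟩ := exists_weighted_form (F := F) hc hM0 hM
  have h := (le_abs_self _).trans (hbM f f)
  rwa [hb, mul_assoc, ← sq] at h

/-- Integration in time of energy inequalities `φᵢ ≤ φᵢ(0) + 2 ∫ sᵢ` whose right-hand sides are
dissipative up to lower order terms. -/
theorem sum_energy_le {T a κ B Φ : ℝ} {φ₁ φ₂ s₁ s₂ N D z : ℝ → ℝ} {p₁ p₂ : ℝ}
    (i₁ : Integrable s₁ (timeMeasure T)) (i₂ : Integrable s₂ (timeMeasure T))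
    (hN : Integrable N (timeMeasure T)) (hD : Integrable D (timeMeasure T))
    (hz : Integrable z (timeMeasure T)) (hz0 : ∀ t, 0 ≤ z t)
    (e₁ : ∀ᵐ t ∂timeMeasure T, φ₁ t ≤ p₁ + 2 * ∫ s in Ioo 0 t, s₁ s)
    (e₂ : ∀ᵐ t ∂timeMeasure T, φ₂ t ≤ p₂ + 2 * ∫ s in Ioo 0 t, s₂ s)
    (hφ : ∀ t, a * N t ≤ φ₁ t + φ₂ t) (hp : p₁ + p₂ ≤ Φ)
    (hs : ∀ t, s₁ t + s₂ t ≤ -(κ / 2) * D t + B * N t + z t) :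
    ∀ᵐ t ∂timeMeasure T, a * N t + κ * (∫ s in Ioo 0 t, D s)
      ≤ Φ + 2 * (∫ s in Ioo 0 T, z s) + 2 * B * ∫ s in Ioo 0 t, N s := by
  filter_upwards [e₁, e₂, ae_restrict_mem measurableSet_Ioo] with t h₁ h₂ ht
  have hsub : Ioo 0 t ⊆ Ioo 0 T := Ioo_subset_Ioo_right ht.2.le
  have r : ∀ {f : ℝ → ℝ}, Integrable f (timeMeasure T) → IntegrableOn f (Ioo 0 t) volume :=
    fun hf => IntegrableOn.mono_set hf hsub
  have j₁ := (r hD).const_mul (-(κ / 2))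
  have j₂ := (r hN).const_mul B
  have j : Integrable (fun s => -(κ / 2) * D s + B * N s) (volume.restrict (Ioo 0 t)) := j₁.add j₂
  have hint : ∫ s in Ioo 0 t, (s₁ s + s₂ s)
      ≤ ∫ s in Ioo 0 t, (-(κ / 2) * D s + B * N s + z s) :=
    integral_mono ((r i₁).add (r i₂)) (j.add (r hz)) hs
  have hzt : (∫ s in Ioo 0 t, z s) ≤ ∫ s in Ioo 0 T, z s :=
    setIntegral_mono_set hz (ae_of_all _ hz0) hsub.eventuallyLE
  rw [integral_add (r i₁) (r i₂), integral_add j (r hz),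
    integral_add j₁ j₂,
    integral_const_mul, integral_const_mul] at hint
  linarith [hφ t]

/-- Bounds for sums of squared norms of two functions bound the norms of the first one. -/
theorem eLpNorm_le_of_sum_sq_le {d : ℕ} {T : ℝ} {Ω : Set (Sp d)} (u₁ u₂ : L2V T Ω) {K₁ K₂ K₃ : ℝ}
    (b₁ : ∀ᵐ t ∂timeMeasure T, ‖V.fn (u₁ t)‖ ^ 2 + ‖V.fn (u₂ t)‖ ^ 2 ≤ K₁)
    (b₂ : ∫ t in Ioo 0 T, (‖V.fn (u₁ t)‖ ^ 2 + ‖V.fn (u₂ t)‖ ^ 2) ≤ K₂)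
    (b₃ : ∫ t in Ioo 0 T, (‖V.grad (u₁ t)‖ ^ 2 + ‖V.grad (u₂ t)‖ ^ 2) ≤ K₃) :
    eLpNorm (fun t => V.fn (u₁ t)) ⊤ (timeMeasure T)
        ≤ (((√K₁).toNNReal + (√(K₂ + K₃)).toNNReal : ℝ≥0) : ℝ≥0∞) ∧
      eLpNorm u₁ 2 (timeMeasure T) ≤ (((√K₁).toNNReal + (√(K₂ + K₃)).toNNReal : ℝ≥0) : ℝ≥0∞) := by
  have i₁ := integrable_norm_fn_sq u₁
  have i₂ := integrable_norm_fn_sq u₂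
  have j₁ := integrable_norm_grad_sq u₁
  have j₂ := integrable_norm_grad_sq u₂
  refine eLpNorm_le_of_sq_le u₁ (K₁ := K₁) (K₂ := K₂ + K₃)
    (b₁.mono fun t ht => (le_add_of_nonneg_right (sq_nonneg _)).trans ht) ?_ ?_ ?_
  · simp only [V.norm_sq_eq]
    rw [integral_add i₁ j₁]
    refine add_le_add (le_trans ?_ b₂) (le_trans ?_ b₃)
    · exact integral_mono i₁ (i₁.add i₂) fun t => le_add_of_nonneg_right (sq_nonneg _)
    · exact integral_mono j₁ (j₁.add j₂) fun t => le_add_of_nonneg_right (sq_nonneg _)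
  · simp
  · simp

/-- The energy estimate for every solution of the system, with constants that do not depend
on `ε`. -/
theorem exists_energy_bound {d : ℕ} {Ω : Set (Sp d)} (hΩ_open : IsOpen Ω)
    (hΩ_bdd : Bornology.IsBounded Ω) {T : ℝ} (hT : 0 < T) {C₁₁ C₂₂ κ₁ κ₂ Q : Sp d → Sp d → ℝ}
    (hC₁₁ : IsCoefficient Ω C₁₁) (hC₂₂ : IsCoefficient Ω C₂₂) (hκ₁ : IsCoefficient Ω κ₁)
    (hκ₂ : IsCoefficient Ω κ₂) (hQ : IsCoefficient Ω Q) {Cmin κmin : ℝ} (hCmin : 0 < Cmin)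
    (hκmin : 0 < κmin) (hC : ∀ x ∈ Ω, ∀ y, Cmin ≤ C₁₁ x y ∧ Cmin ≤ C₂₂ x y)
    (hκ : ∀ x ∈ Ω, ∀ y, κmin ≤ κ₁ x y ∧ κmin ≤ κ₂ x y) {q : ℝ × Sp d → ℝ}
    (hq : MemLp q 2 ((timeMeasure T).prod (spaceMeasure Ω))) (g₁ g₂ : H Ω)
    {R : Sp d → Sp d → Sp d} (hR : IsC1C1 Ω R)
    (hRQ : ∀ x ∈ Ω, ∀ y, divergence (R x) y = Q x y) :
    ∃ A B : ℝ, 0 ≤ A ∧ 0 ≤ B ∧ ∀ ε : ℝ, 0 < ε → ∀ u₁ u₂ : L2V T Ω,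
      IsSolution T Ω C₁₁ C₂₂ κ₁ κ₂ Q q g₁ g₂ ε u₁ u₂ →
      ∀ᵐ t ∂timeMeasure T, Cmin * (‖V.fn (u₁ t)‖ ^ 2 + ‖V.fn (u₂ t)‖ ^ 2)
          + κmin * (∫ s in Ioo 0 t, (‖V.grad (u₁ s)‖ ^ 2 + ‖V.grad (u₂ s)‖ ^ 2))
        ≤ A + B * ∫ s in Ioo 0 t, (‖V.fn (u₁ s)‖ ^ 2 + ‖V.fn (u₂ s)‖ ^ 2) := by
  have : Fact ((2 : ℝ≥0∞) ≠ ⊤) := ⟨by simp⟩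
  obtain ⟨M₁, hM₁0, hM₁⟩ := hC₁₁.exists_osc_bound hΩ_open
  obtain ⟨M₂, hM₂0, hM₂⟩ := hC₂₂.exists_osc_bound hΩ_open
  obtain ⟨L₁, hL₁0, hL₁⟩ := hκ₁.exists_osc_bound hΩ_open
  obtain ⟨L₂, hL₂0, hL₂⟩ := hκ₂.exists_osc_bound hΩ_open
  obtain ⟨MQ, hMQ0, hMQ⟩ := hQ.exists_osc_bound hΩ_open
  obtain ⟨C, hC0, hCb⟩ := exists_reaction_bound hΩ_open hΩ_bdd hQ hR hRQ
  obtain ⟨Z, hZ, hZq⟩ := exists_Lp_section hq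
  have hZ2 : MeasureTheory.Integrable (fun t => ‖Z t‖ ^ 2) (timeMeasure T) :=
    hZ.integrable_norm_pow (by norm_num)
  refine ⟨M₁ * ‖g₁‖ ^ 2 + M₂ * ‖g₂‖ ^ 2 + 2 * ∫ t in Ioo 0 T, ‖Z t‖ ^ 2,
    2 * (2 * C + 2 * C ^ 2 / κmin + 1 / 2), by positivity, by positivity,
    fun ε hε u₁ u₂ hu => ?_⟩
  have hmem := ae_restrict_mem (μ := volume) hΩ_open.measurableSet
  have hC₁pos : ∀ᵐ x ∂spaceMeasure Ω, Cmin ≤ osc C₁₁ ε x := hmem.mono fun x hx => (hC x hx _).1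
  have hC₂pos : ∀ᵐ x ∂spaceMeasure Ω, Cmin ≤ osc C₂₂ ε x := hmem.mono fun x hx => (hC x hx _).2
  have hκ₁pos : ∀ᵐ x ∂spaceMeasure Ω, κmin ≤ osc κ₁ ε x := hmem.mono fun x hx => (hκ x hx _).1
  have hκ₂pos : ∀ᵐ x ∂spaceMeasure Ω, κmin ≤ osc κ₂ ε x := hmem.mono fun x hx => (hκ x hx _).2
  have hC₁m := hC₁₁.aestronglyMeasurable_osc hΩ_open ε
  have hC₂m := hC₂₂.aestronglyMeasurable_osc hΩ_open ε
  have hκ₁m := hκ₁.aestronglyMeasurable_osc hΩ_open ε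
  have hκ₂m := hκ₂.aestronglyMeasurable_osc hΩ_open ε
  have hrm : AEStronglyMeasurable (fun x => (1 / ε) * osc Q ε x) (spaceMeasure Ω) :=
    (hQ.aestronglyMeasurable_osc hΩ_open ε).const_mul _
  have hr0 : 0 ≤ 1 / ε * MQ := by positivity
  have hrM : ∀ᵐ x ∂spaceMeasure Ω, |(1 / ε) * osc Q ε x| ≤ 1 / ε * MQ := by
    filter_upwards [hMQ ε] with x hx
    rw [abs_mul, abs_of_pos (by positivity : 0 < 1 / ε)]
    gcongr
  have hrC := hCb ε
  simp only [← one_div] at hrC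
  obtain ⟨i₁, e₁⟩ := WeakEquation.energy_inequality hT hC₁m hM₁0 (hM₁ ε)
    (hC₁pos.mono fun x hx => hCmin.le.trans hx) hκ₁m hL₁0 (hL₁ ε) hrm hr0 hrM hZ hZq hu.first
  obtain ⟨i₂, e₂⟩ := WeakEquation.energy_inequality hT hC₂m hM₂0 (hM₂ ε)
    (hC₂pos.mono fun x hx => hCmin.le.trans hx) hκ₂m hL₂0 (hL₂ ε) hrm hr0 hrM hZ hZq hu.second
  have hdiss := fun v₁ v₂ z => dissipation_le hκ₁m (hL₁ ε) hκ₂m (hL₂ ε) hrm hr0 hrM hκmin hκ₁pos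
    hκ₂pos hC0 hrC v₁ v₂ z
  refine sum_energy_le i₁ i₂ ((integrable_norm_fn_sq u₁).add (integrable_norm_fn_sq u₂))
    ((integrable_norm_grad_sq u₁).add (integrable_norm_grad_sq u₂)) hZ2
    (fun t => sq_nonneg _) e₁ e₂ (fun t => ?_) ?_ fun t => hdiss (u₁ t) (u₂ t) (Z t)
  · have l₁ := mul_norm_sq_le_integral_weight hC₁m (hM₁ ε) hC₁pos (V.fn (u₁ t))
    have l₂ := mul_norm_sq_le_integral_weight hC₂m (hM₂ ε) hC₂pos (V.fn (u₂ t))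
    rw [mul_add]
    exact add_le_add l₁ l₂
  · exact add_le_add (integral_weight_le hC₁m hM₁0 (hM₁ ε) g₁)
      (integral_weight_le hC₂m hM₂0 (hM₂ ε) g₂)

end DualContinuum

end

theorem theoremA1 {d : ℕ} (Ω : Set (DualContinuum.Sp d))
    (hΩ_open : IsOpen Ω) (hΩ_bdd : Bornology.IsBounded Ω) (T : ℝ) (hT : 0 < T)
    (C₁₁ C₂₂ κ₁ κ₂ Q : DualContinuum.Sp d → DualContinuum.Sp d → ℝ)
    (hC₁₁ : DualContinuum.IsCoefficient Ω C₁₁) (hC₂₂ : DualContinuum.IsCoefficient Ω C₂₂)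
    (hκ₁ : DualContinuum.IsCoefficient Ω κ₁) (hκ₂ : DualContinuum.IsCoefficient Ω κ₂)
    (hQ : DualContinuum.IsCoefficient Ω Q)
    (hQ_mean : ∀ x ∈ Ω, ∫ y in DualContinuum.unitCube d, Q x y = 0)
    (Cmin κmin : ℝ) (hCmin : 0 < Cmin) (hκmin : 0 < κmin)
    (hC : ∀ x ∈ Ω, ∀ y, Cmin ≤ C₁₁ x y ∧ Cmin ≤ C₂₂ x y)
    (hκ : ∀ x ∈ Ω, ∀ y, κmin ≤ κ₁ x y ∧ κmin ≤ κ₂ x y)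
    (q : ℝ × DualContinuum.Sp d → ℝ)
    (hq : MemLp q 2 ((DualContinuum.timeMeasure T).prod (DualContinuum.spaceMeasure Ω)))
    (g₁ g₂ : DualContinuum.H Ω)
    (R : DualContinuum.Sp d → DualContinuum.Sp d → DualContinuum.Sp d)
    (hR : DualContinuum.IsC1C1 Ω R)
    (hRQ : ∀ x ∈ Ω, ∀ y, DualContinuum.divergence (R x) y = Q x y) :
    ∃ K : ℝ≥0, ∀ ε : ℝ, 0 < ε → ∀ u₁ u₂ : DualContinuum.L2V T Ω,
      DualContinuum.IsSolution T Ω C₁₁ C₂₂ κ₁ κ₂ Q q g₁ g₂ ε u₁ u₂ →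
        eLpNorm (fun t => DualContinuum.V.fn (u₁ t)) ∞ (DualContinuum.timeMeasure T) ≤ (K : ℝ≥0∞) ∧
        eLpNorm (fun t => DualContinuum.V.fn (u₂ t)) ∞ (DualContinuum.timeMeasure T) ≤ (K : ℝ≥0∞) ∧
        eLpNorm u₁ 2 (DualContinuum.timeMeasure T) ≤ (K : ℝ≥0∞) ∧
        eLpNorm u₂ 2 (DualContinuum.timeMeasure T) ≤ (K : ℝ≥0∞) := by
  obtain ⟨A, B, hA, hB, h⟩ := DualContinuum.exists_energy_bound hΩ_open hΩ_bdd hT hC₁₁ hC₂₂ hκ₁ hκ₂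
    hQ hCmin hκmin hC hκ hq g₁ g₂ hR hRQ
  let G : ℝ := DualContinuum.gronwallConst T (A / Cmin) (B / Cmin)
  refine ⟨(√G).toNNReal + (√(T * G + (A + B * (T * G)) / κmin)).toNNReal,
    fun ε hε u₁ u₂ hu => ?_⟩
  obtain ⟨b₁, b₂, b₃⟩ := DualContinuum.bounds_of_energy_inequality hT hCmin hκmin hA hB
    ((DualContinuum.integrable_norm_fn_sq u₁).add (DualContinuum.integrable_norm_fn_sq u₂))
    ((DualContinuum.integrable_norm_grad_sq u₁).add (DualContinuum.integrable_norm_grad_sq u₂))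
    (fun t => add_nonneg (sq_nonneg _) (sq_nonneg _))
    (fun t => add_nonneg (sq_nonneg _) (sq_nonneg _)) (h ε hε u₁ u₂ hu)
  obtain ⟨p₁, q₁⟩ := DualContinuum.eLpNorm_le_of_sum_sq_le u₁ u₂ b₁ b₂ b₃
  simp only [Pi.add_apply, add_comm (‖DualContinuum.V.fn (u₁ _)‖ ^ 2),
    add_comm (‖DualContinuum.V.grad (u₁ _)‖ ^ 2)] at b₁ b₂ b₃
  obtain ⟨p₂, q₂⟩ := DualContinuum.eLpNorm_le_of_sum_sq_le u₂ u₁ b₁ b₂ b₃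
  exact ⟨p₁, p₂, q₁, q₂⟩
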